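/- Let $\mathcal H$ be a real Hilbert space. For a set-valued operator $A\colon\mathcal H\to2^{\mathcal H}$ write $\operatorname{dom}A=\{x\mid Ax\neq\varnothing\}$, $\operatorname{zer}A=\{x\mid 0\in Ax\}$ and $J_A=(\mathrm{Id}+A)^{-1}$, where $A^{-1}u=\{x\mid u\in Ax\}$. $A$ is monotone if $\langle x-y,u-v\rangle\ge0$ whenever $u\in Ax$ and $v\in Ay$, and maximally monotone if moreover no other monotone operator has a graph containing that of $A$. $A$ is demiregular at $x\in\operatorname{dom}A$ if, for all sequences with $u_n\in Ax_n$ and every $u\in Ax$ such that $x_n\rightharpoonup x$ (weakly) and $u_n\to u$, one has $x_n\to x$. For self-adjoint bounded operators, $U\succcurlyeq V$ means $\langle Ux,x\rangle\ge\langle Vx,x\rangle$ for all $x\in\mathcal H$; $\mathcal P_\alpha(\mathcal H)$ is the set of self-adjoint bounded operators $U$ with $U\succcurlyeq\alpha\,\mathrm{Id}$; $\ell^1_+(\mathbb N)$ is the set of summable sequences in $[0,+\infty[$; $d_Z(x)=\inf_{z\in Z}\|x-z\|$. **Theorem.** Let $A\colon\mathcal H\to2^{\mathcal H}$ be maximally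 monotone, let $\alpha>0$ and $\beta>0$, let $B\colon\mathcal H\to\mathcal H$ be $\beta$-cocoercive, i.e. $\langle x-y,Bx-By\rangle\ge\beta\|Bx-By\|^2$ for all $x,y\in\mathcal H$, let $(\eta_n)_{n\in\mathbb N}\in\ell^1_+(\mathbb N)$, and let $(U_n)_{n\in\mathbb N}$ be a sequence in $\mathcal P_\alpha(\mathcal H)$ such that $$\mu=\sup_{n}\|U_n\|<+\infty\quad\text{and}\quad(\forall n\in\mathbb N)\;\;(1+\eta_n)U_{n+1}\succcurlyeq U_n .$$ Let $\varepsilon\in\,]0,\min\{1,2\beta/(\mu+1)\}]$, let $(\lambda_n)$ be a sequence in $[\varepsilon,1]$, let $(\gamma_n)$ be a sequence in $[\varepsilon,(2\beta-\varepsilon)/\mu]$ (i.e. $\varepsilon\le\gamma_n$ and $\gamma_n\mu\le2\beta-\varepsilon$), and let $(a_n)$ and $(b_n)$ be absolutely summable sequences in $\mathcal H$ (that is, $\sum_n\|a_n\|<+\infty$ and $\sum_n\|b_n\|<+\infty$). Suppose that $Z=\operatorname{zer}(A+B)\neq\varnothing$. Then every resolvent $J_{\gamma_nU_nA}$ is single-valued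 and defined on all of $\mathcal H$. Let $x_0\in\mathcal H$ and set $$(\forall n\in\mathbb N)\qquad y_n=x_n-\gamma_nU_n(Bx_n+b_n),\qquad x_{n+1}=x_n+\lambda_n\big(J_{\gamma_nU_nA}(y_n)+a_n-x_n\big).$$ Then the following hold for some $\overline x\in Z$. 1. $x_n\rightharpoonup\overline x$. 2. $\sum_{n\in\mathbb N}\|Bx_n-B\overline x\|^2<+\infty$. 3. Suppose that one of the following holds: (a) $\liminf d_Z(x_n)=0$; (b) at every point of $Z$, $A$ or $B$ is demiregular; (c) $\operatorname{int}Z\neq\varnothing$ and there exists $(\nu_n)_{n\in\mathbb N}\in\ell^1_+(\mathbb N)$ such that $(1+\nu_n)U_n\succcurlyeq U_{n+1}$ for every $n\in\mathbb N$. Then $x_n\to\overline x$. -/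

import Mathlib

open Filter Topology
open scoped Pointwise

namespace MonotoneInclusion

section SetValued

variable {H : Type*} [NormedAddCommGroup H] [InnerProductSpace ℝ H]

/-- The domain of a set-valued operator `A : H → 2^H`. -/
def dom (A : H → Set H) : Set H := {x | (A x).Nonempty}

/-- The set of zeros `{x | 0 ∈ A x}` of a set-valued operator. -/
def zer (A : H → Set H) : Set H := {x | (0 : H) ∈ A x}

/-- The inverse `u ↦ {x | u ∈ A x}` of a set-valued operator. -/
def inverse (A : H → Set H) : H → Set H := fun u => {x | u ∈ A x}

/-- A single-valued operator seen as a set-valued one. -/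
def single (B : H → H) : H → Set H := fun x => {B x}

/-- The resolvent `J_A = (Id + A)⁻¹`, as a set-valued operator; the sum of two set-valued
operators is the pointwise Minkowski sum. -/
def resolvent (A : H → Set H) : H → Set H := inverse (single id + A)

/-- The composition `L A : x ↦ {L u | u ∈ A x}` of a bounded linear operator with a set-valued
operator. -/
def lcomp (L : H →L[ℝ] H) (A : H → Set H) : H → Set H := fun x => L '' A x

/-- Monotone set-valued operators. -/
def IsMonotone (A : H → Set H) : Prop :=
  ∀ x y, ∀ u ∈ A x, ∀ v ∈ A y, 0 ≤ inner ℝ (x - y) (u - v)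

/-- Maximally monotone operators: monotone, and without a proper monotone extension. -/
def IsMaximallyMonotone (A : H → Set H) : Prop :=
  IsMonotone A ∧ ∀ A' : H → Set H, IsMonotone A' → (∀ x, A x ⊆ A' x) → A = A'

/-- `B` is `β`-cocoercive. -/
def IsCocoercive (β : ℝ) (B : H → H) : Prop :=
  ∀ x y, β * ‖B x - B y‖ ^ 2 ≤ inner ℝ (x - y) (B x - B y)

/-- Weak convergence of a sequence, i.e. convergence in the weak topology. -/
def WeaklyTendsto (x : ℕ → H) (l : H) : Prop :=
  Tendsto (fun n => toWeakSpace ℝ H (x n)) atTop (𝓝 (toWeakSpace ℝ H l))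

/-- `A` is demiregular at `x ∈ dom A`. -/
def IsDemiregularAt (A : H → Set H) (x : H) : Prop :=
  x ∈ dom A ∧ ∀ (xs us : ℕ → H), (∀ n, us n ∈ A (xs n)) → ∀ u ∈ A x,
    WeaklyTendsto xs x → Tendsto us atTop (𝓝 u) → Tendsto xs atTop (𝓝 x)

/-- Summable sequences in `[0, +∞[`. -/
def IsNonnegSummable (η : ℕ → ℝ) : Prop := (∀ n, 0 ≤ η n) ∧ Summable η

end SetValued

section Hilbert

variable {H : Type*} [NormedAddCommGroup H] [InnerProductSpace ℝ H] [CompleteSpace H]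

/-- The class `P_α(H)` of self-adjoint bounded operators `U` with `U ≽ α Id` in the Loewner
order. -/
def posClass (H : Type*) [NormedAddCommGroup H] [InnerProductSpace ℝ H] [CompleteSpace H]
    (α : ℝ) : Set (H →L[ℝ] H) :=
  {U | IsSelfAdjoint U ∧ α • ContinuousLinearMap.id ℝ H ≤ U}

/-- In a Hilbert space, weak convergence is tested against inner products. -/
theorem weaklyTendsto_iff (x : ℕ → H) (l : H) :
    WeaklyTendsto x l ↔
      ∀ y, Tendsto (fun n => inner ℝ (x n) y) atTop (𝓝 (inner ℝ l y)) := by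
  have h := WeakBilin.tendsto_iff_forall_eval_tendsto (B := (topDualPairing ℝ H).flip)
    (l := atTop) (f := fun n => toWeakSpace ℝ H (x n)) (x := toWeakSpace ℝ H l) (by
      intro u v huv
      refine ext_inner_left ℝ fun w => ?_
      exact LinearMap.congr_fun huv (innerSL ℝ w))
  refine Iff.trans h ⟨fun h y => ?_, fun h f => ?_⟩
  · have := h (innerSL ℝ y)
    simp only [real_inner_comm y]
    exact this
  · have := h ((InnerProductSpace.toDual ℝ H).symm f)
    have e : ∀ z, inner ℝ z ((InnerProductSpace.toDual ℝ H).symm f) = f z := fun z => by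
      rw [real_inner_comm]; simp
    simp only [e] at this
    exact this

/-- On self-adjoint operators, the order of bounded operators is the Loewner order
`U ≽ V ↔ ∀ x, ⟪U x, x⟫ ≥ ⟪V x, x⟫`. -/
theorem loewner_iff {U V : H →L[ℝ] H} (hU : IsSelfAdjoint U) (hV : IsSelfAdjoint V) :
    V ≤ U ↔ ∀ x, inner ℝ (V x) x ≤ inner ℝ (U x) x := by
  rw [ContinuousLinearMap.le_def, ContinuousLinearMap.isPositive_def']
  simp [hU.sub hV, ContinuousLinearMap.reApplyInnerSelf, inner_sub_left]

end Hilbert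

end MonotoneInclusion

/-! Write S_n for the inverse of U_n and measure step n in the norm of S_n. Inversion reverses the
Loewner order, so (1 + η_n) U_{n+1} ≽ U_n becomes S_{n+1} ≼ (1 + η_n) S_n: the metrics are uniformly
equivalent and almost decreasing. In the metric of S_n, one exact forward-backward step brings x_n
closer to every zero z, with a gain controlling ‖Bx_n - Bz‖² and the residual x_n - q_n - γ_n
U_n(Bx_n - Bz) (`forwardBackward_quad_le`). Relaxation keeps a fraction ε of the gain, and the
errors only add summable terms (`relaxed_quad_le`). Thus x is quasi-Fejér relative to Z and the
gains are summable (`tendsto_and_summable_of_quasiFejer`).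

It follows that Bx_n → Bz and x_n - q_n → 0, and that some u_n ∈ A q_n tends to -Bz. Weak-strong
closedness of the graph of A places every weak cluster point in Z. Two such points coincide because
S_n converges strongly (`IsQuasiFejer.weak_limit_unique`).

Strong convergence under (a) and (c) is a property of quasi-Fejér sequences; under (b) it is
demiregularity applied to u_n ∈ A q_n or to Bx_n.

The resolvents are well defined by Minty's theorem in a variable metric, proved by minimising a
strongly convex function over the epigraph of the Fitzpatrick function. -/

namespace MonotoneInclusion

/-! ### Quadratic forms of symmetric operators and the Loewner order -/

section Quadratic

variable {H : Type*} [NormedAddCommGroup H] [InnerProductSpace ℝ H]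

/-- Symmetry of a bounded operator, in the form that swaps the two arguments. -/
def IsSymm (S : H →L[ℝ] H) : Prop := ∀ x y, inner ℝ (S x) y = inner ℝ (S y) x

theorem IsSymm.quad_add {S : H →L[ℝ] H} (hS : IsSymm S) (u v : H) :
    inner ℝ (S (u + v)) (u + v) =
      inner ℝ (S u) u + 2 * inner ℝ (S u) v + inner ℝ (S v) v := by
  simp only [map_add, inner_add_left, inner_add_right]
  rw [hS v u]; ring

theorem IsSymm.quad_sub {S : H →L[ℝ] H} (hS : IsSymm S) (u v : H) :
    inner ℝ (S (u - v)) (u - v) =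
      inner ℝ (S u) u - 2 * inner ℝ (S u) v + inner ℝ (S v) v := by
  simp only [map_sub, inner_sub_left, inner_sub_right]
  rw [hS v u]; ring

theorem quad_smul (S : H →L[ℝ] H) (t : ℝ) (u : H) :
    inner ℝ (S (t • u)) (t • u) = t ^ 2 * inner ℝ (S u) u := by
  simp only [map_smul, inner_smul_left, inner_smul_right, RCLike.conj_to_real]; ring

theorem abs_quad_le {S : H →L[ℝ] H} {C : ℝ} (hC : ∀ x, ‖S x‖ ≤ C * ‖x‖) (x : H) :
    |inner ℝ (S x) x| ≤ C * ‖x‖ ^ 2 := by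
  refine (abs_real_inner_le_norm _ _).trans ?_
  nlinarith [hC x, norm_nonneg x]

/-- A positive operator satisfies `‖T x‖² ≤ C ⟪T x, x⟫` for every bound `C` of its norm. -/
theorem IsSymm.norm_sq_le {T : H →L[ℝ] H} (hT : IsSymm T)
    (hpos : ∀ x, 0 ≤ inner ℝ (T x) x) {C : ℝ} (hC0 : 0 < C) (hC : ∀ x, ‖T x‖ ≤ C * ‖x‖) (x : H) :
    ‖T x‖ ^ 2 ≤ C * inner ℝ (T x) x := by
  -- Expanding gives 0 ≤ C²⟪Tx, x⟫ - 2C‖Tx‖² + ⟪T(Tx), Tx⟫, and the last term is at most C‖Tx‖².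
  have h := hpos (C • x - T x)
  rw [hT.quad_sub, quad_smul] at h
  have h1 := (abs_le.1 (abs_quad_le hC (T x))).2
  have h2 : inner ℝ (T (C • x)) (T x) = C * ‖T x‖ ^ 2 := by
    rw [map_smul, inner_smul_left, real_inner_self_eq_norm_sq]; simp
  rw [h2] at h
  have h3 : 0 ≤ C * (C * inner ℝ (T x) x - ‖T x‖ ^ 2) := by nlinarith
  linarith [nonneg_of_mul_nonneg_right h3 hC0]

/-- Young's inequality for the seminorm of a positive operator, with an error `‖e‖ ≤ δ`. -/
theorem IsSymm.quad_add_le {S : H →L[ℝ] H} (hS : IsSymm S)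
    (hpos : ∀ x, 0 ≤ inner ℝ (S x) x) {C : ℝ} (hC0 : 0 ≤ C) (hC : ∀ x, ‖S x‖ ≤ C * ‖x‖)
    {δ : ℝ} {u e : H} (he : ‖e‖ ≤ δ) :
    inner ℝ (S (u + e)) (u + e) ≤ (1 + δ) * inner ℝ (S u) u + C * (δ + δ ^ 2) := by
  rw [hS.quad_add]
  have hδ : 0 ≤ δ := (norm_nonneg e).trans he
  have h1 : inner ℝ (S e) e ≤ C * δ ^ 2 :=
    ((abs_le.1 (abs_quad_le hC e)).2).trans (by gcongr)
  suffices 2 * inner ℝ (S u) e ≤ δ * inner ℝ (S u) u + C * δ by linarith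
  rcases hδ.eq_or_lt with h0 | h0
  · have : e = 0 := norm_le_zero_iff.1 (he.trans h0.ge)
    simp [this, ← h0]
  -- Positivity at δu - e bounds the cross term after division by δ, hence the separate case δ = 0.
  · have h := hpos (δ • u - e)
    rw [hS.quad_sub, quad_smul, map_smul, inner_smul_left] at h
    simp only [RCLike.conj_to_real] at h
    have h3 : 0 ≤ δ * (δ * inner ℝ (S u) u + C * δ - 2 * inner ℝ (S u) e) := by nlinarith
    linarith [nonneg_of_mul_nonneg_right h3 h0]

/-- Convexity of the quadratic form of a positive operator. -/
theorem IsSymm.quad_convex {S : H →L[ℝ] H} (hS : IsSymm S)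
    (hpos : ∀ x, 0 ≤ inner ℝ (S x) x) {t : ℝ} (h0 : 0 ≤ t) (h1 : t ≤ 1) (u v : H) :
    inner ℝ (S (u + t • (v - u))) (u + t • (v - u)) ≤
      (1 - t) * inner ℝ (S u) u + t * inner ℝ (S v) v := by
  have h := hpos (v - u)
  have e : v = u + (v - u) := by abel
  have e2 : inner ℝ (S v) v = inner ℝ (S u) u + 2 * inner ℝ (S u) (v - u)
      + inner ℝ (S (v - u)) (v - u) := by
    rw [← hS.quad_add, ← e]
  rw [hS.quad_add, quad_smul, inner_smul_right, e2]
  nlinarith [mul_nonneg (mul_nonneg h0 (sub_nonneg.2 h1)) h]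

theorem IsSymm.of_inverse {U S : H →L[ℝ] H} (hU : IsSymm U) (hUS : ∀ x, U (S x) = x) :
    IsSymm S := fun x y => by
  have := hU (S x) (S y)
  rw [hUS, hUS] at this
  rw [real_inner_comm, ← this, real_inner_comm]

/-- Inversion reverses the Loewner order. -/
theorem quad_inverse_antitone {U S V T : H →L[ℝ] H} (hU : IsSymm U) (hUS : ∀ x, U (S x) = x)
    (hVT : ∀ x, V (T x) = x) (hpos : ∀ x, 0 ≤ inner ℝ (U x) x)
    {c : ℝ} (hc : 0 < c) (h : ∀ x, inner ℝ (U x) x ≤ c * inner ℝ (V x) x) (x : H) :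
    inner ℝ (T x) x ≤ c * inner ℝ (S x) x := by
  -- The U-square of Tx - c Sx has cross term c⟪x, Tx⟫, while ⟪U Tx, Tx⟫ ≤ c⟪x, Tx⟫ by comparison
  -- with V.
  have h1 := hpos (T x - c • S x)
  have h2 := h (T x)
  rw [hVT] at h2
  have h4 : inner ℝ (U (T x)) (c • S x) = c * inner ℝ x (T x) := by
    rw [inner_smul_right, hU, hUS]
  rw [hU.quad_sub, quad_smul, hUS, h4] at h1
  rw [← real_inner_comm (S x) x, ← real_inner_comm (T x) x]
  have h3 : 0 ≤ c * (c * inner ℝ x (S x) - inner ℝ x (T x)) := by nlinarith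
  linarith [nonneg_of_mul_nonneg_right h3 hc]

/-- Order reversal applied to U ≼ μ Id, the identity being its own inverse. -/
theorem sq_norm_le_of_inverse {U S : H →L[ℝ] H} (hU : IsSymm U) (hUS : ∀ x, U (S x) = x)
    {α μ : ℝ} (hα : 0 < α) (hlow : ∀ x, α * ‖x‖ ^ 2 ≤ inner ℝ (U x) x)
    (hμ : ∀ x, ‖U x‖ ≤ μ * ‖x‖) (x : H) :
    ‖x‖ ^ 2 ≤ μ * inner ℝ (S x) x := by
  rcases eq_or_ne x 0 with rfl | hx
  · simp
  have hx2 : 0 < ‖x‖ ^ 2 := by positivity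
  have hup : ∀ y, inner ℝ (U y) y ≤ μ * ‖y‖ ^ 2 := fun y =>
    (abs_le.1 (abs_quad_le hμ y)).2
  have hμ0 : 0 < μ := by
    have := (hlow x).trans (hup x)
    by_contra! h
    nlinarith [mul_pos hα hx2]
  have := quad_inverse_antitone (V := .id ℝ H) (T := .id ℝ H) hU hUS (fun _ => rfl)
    (fun y => le_trans (by positivity) (hlow y)) hμ0 (fun y => by
      simpa [real_inner_self_eq_norm_sq] using hup y) x
  simpa [real_inner_self_eq_norm_sq] using this

theorem norm_inverse_le {U S : H →L[ℝ] H} (hUS : ∀ x, U (S x) = x)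
    {α : ℝ} (hα : 0 < α) (hlow : ∀ x, α * ‖x‖ ^ 2 ≤ inner ℝ (U x) x) (x : H) :
    ‖S x‖ ≤ α⁻¹ * ‖x‖ := by
  have h := hlow (S x)
  rw [hUS] at h
  have h2 := (real_inner_le_norm x (S x))
  rcases (norm_nonneg (S x)).eq_or_lt with h0 | h0
  · rw [← h0]; positivity
  · rw [inv_mul_eq_div, le_div_iff₀ hα]
    have h3 : 0 ≤ ‖S x‖ * (‖x‖ - ‖S x‖ * α) := by nlinarith
    linarith [nonneg_of_mul_nonneg_right h3 h0]

/-- Bounded symmetric operators that decrease up to a summable perturbation converge strongly. -/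
theorem exists_tendsto_of_quad_le [CompleteSpace H] {S : ℕ → H →L[ℝ] H} (hS : ∀ n, IsSymm (S n))
    {C : ℝ} (hC0 : 0 ≤ C) (hC : ∀ n x, ‖S n x‖ ≤ C * ‖x‖) {c : ℕ → ℝ} (hc : IsNonnegSummable c)
    (h : ∀ n x, inner ℝ (S (n + 1) x) x ≤ inner ℝ (S n x) x + c n * ‖x‖ ^ 2) (w : H) :
    ∃ l, Tendsto (fun n => S n w) atTop (𝓝 l) := by
  set s : ℕ → ℝ := fun n => ∑ k ∈ Finset.range n, c k with hs
  have hs0 : ∀ n, 0 ≤ s n := fun n => Finset.sum_nonneg fun k _ => hc.1 k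
  have hsle : ∀ n, s n ≤ ∑' k, c k := fun n => hc.2.sum_le_tsum _ fun k _ => hc.1 k
  set K := ∑' k, c k with hK
  have hK0 : 0 ≤ K := (hs0 0).trans (hsle 0)
  have hslim : Tendsto s atTop (𝓝 K) := hc.2.hasSum.tendsto_sum_nat
  -- Subtracting the partial sums of c makes the forms genuinely decreasing; the multiple K w is
  -- restored at the end.
  set T : ℕ → H →L[ℝ] H := fun n => S n - s n • ContinuousLinearMap.id ℝ H with hT
  have hTq : ∀ n x, inner ℝ (T n x) x = inner ℝ (S n x) x - s n * ‖x‖ ^ 2 := fun n x => by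
    simp [hT, inner_sub_left, inner_smul_left]
  have hTs : ∀ n, IsSymm (T n) := fun n x y => by
    simp only [hT, sub_apply, smul_apply,
      ContinuousLinearMap.id_apply, inner_sub_left, inner_smul_left, hS n x y,
      real_inner_comm x y]
  have hTC : ∀ n x, ‖T n x‖ ≤ (C + K) * ‖x‖ := fun n x => by
    simp only [hT, sub_apply, smul_apply,
      ContinuousLinearMap.id_apply]
    refine (norm_sub_le _ _).trans ?_
    rw [norm_smul, Real.norm_of_nonneg (hs0 n), add_mul]
    gcongr
    · exact hC n x
    · exact hsle n
  have hanti : ∀ x, Antitone fun n => inner ℝ (T n x) x := fun x =>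
    antitone_nat_of_succ_le fun n => by
      rw [hTq, hTq]
      have : s (n + 1) = s n + c n := Finset.sum_range_succ _ _
      rw [this]; linarith [h n x]
  have hbdd : BddBelow (Set.range fun n => inner ℝ (T n w) w) :=
    ⟨-((C + K) * ‖w‖ ^ 2), by
      rintro _ ⟨n, rfl⟩
      exact (abs_le.1 (abs_quad_le (hTC n) w)).1⟩
  have hlim := tendsto_atTop_ciInf (hanti w) hbdd
  have hcau := hlim.cauchySeq
  set D := 2 * (C + K) + 1 with hD
  have hD0 : 0 < D := by positivity
  -- T_n - T_m is positive with norm at most D, so `IsSymm.norm_sq_le` turns convergence of the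
  -- scalars ⟪T_n w, w⟫ into a Cauchy estimate for T_n w.
  have hkey : ∀ n m, n ≤ m → ‖T n w - T m w‖ ^ 2 ≤
      D * (inner ℝ (T n w) w - inner ℝ (T m w) w) := fun n m hnm => by
    have := IsSymm.norm_sq_le (T := T n - T m) (C := D)
      (fun x y => by simp only [sub_apply, inner_sub_left, hTs n x y, hTs m x y])
      (fun x => by
        simpa [inner_sub_left] using hanti x hnm) hD0
      (fun x => by
        rw [sub_apply]
        refine (norm_sub_le _ _).trans ?_
        have := hTC n x
        have := hTC m x
        rw [hD]; nlinarith [norm_nonneg x]) w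
    simpa [inner_sub_left] using this
  have hTcau : CauchySeq fun n => T n w := by
    rw [Metric.cauchySeq_iff'] at hcau ⊢
    intro ε hε
    obtain ⟨N, hN⟩ := hcau (ε ^ 2 / D) (by positivity)
    refine ⟨N, fun n hn => ?_⟩
    have h1 := hN n hn
    rw [dist_comm, Real.dist_eq] at h1
    have h2 := hkey N n hn
    rw [dist_comm, dist_eq_norm]
    have h3 := lt_of_le_of_lt (le_abs_self _) h1
    rw [lt_div_iff₀ hD0] at h3
    exact lt_of_pow_lt_pow_left₀ 2 hε.le (by linarith)
  obtain ⟨l, hl⟩ := cauchySeq_tendsto_of_complete hTcau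
  refine ⟨l + K • w, ?_⟩
  have := hl.add (hslim.smul_const w)
  simpa [hT] using this

theorem quad_le_of_le {U V : H →L[ℝ] H} (h : U ≤ V) (x : H) :
    inner ℝ (U x) x ≤ inner ℝ (V x) x := by
  have := ((ContinuousLinearMap.le_def _ _).1 h).inner_nonneg_left x
  simpa [inner_sub_left] using this

end Quadratic

/-! ### Inverses of coercive operators -/

section Hilbert

variable {H : Type*} [NormedAddCommGroup H] [InnerProductSpace ℝ H] [CompleteSpace H]

theorem IsSymm.of_isSelfAdjoint {U : H →L[ℝ] H} (h : IsSelfAdjoint U) : IsSymm U := fun x y => by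
  have := ContinuousLinearMap.isSelfAdjoint_iff_isSymmetric.1 h x y
  simp only [ContinuousLinearMap.coe_coe] at this
  rw [this, real_inner_comm]

theorem quad_lower_of_mem_posClass {α : ℝ} {U : H →L[ℝ] H} (h : U ∈ posClass H α) (x : H) :
    α * ‖x‖ ^ 2 ≤ inner ℝ (U x) x := by
  simpa [inner_smul_left] using quad_le_of_le h.2 x

/-- A coercive bounded operator is invertible. -/
theorem exists_inverse {α : ℝ} (hα : 0 < α) {U : H →L[ℝ] H}
    (hlow : ∀ x, α * ‖x‖ ^ 2 ≤ inner ℝ (U x) x) :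
    ∃ S : H →L[ℝ] H, (∀ x, U (S x) = x) ∧ ∀ x, S (U x) = x := by
  -- Lax–Milgram for the bilinear form ⟪Ux, y⟫.
  let b : H →L[ℝ] H →L[ℝ] ℝ := (innerSL ℝ).comp U
  have hb : IsCoercive b := ⟨α, hα, fun u => by simpa [b, sq, mul_assoc] using hlow u⟩
  have hU : ∀ x, hb.continuousLinearEquivOfBilin x = U x := fun x => by
    refine (hb.unique_continuousLinearEquivOfBilin (f := U x) fun w => ?_).symm
    simp [b]
  refine ⟨hb.continuousLinearEquivOfBilin.symm, fun x => ?_, fun x => ?_⟩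
  · rw [← hU]; simp
  · rw [← hU]; simp

end Hilbert

/-! ### Almost decreasing real sequences -/

section RealSequences

/-- Iterating `d (n + 1) ≤ (1 + κ n) d n + ζ n` with `κ`, `ζ` summable. -/
theorem le_mul_add_sum_of_le {d κ ζ : ℕ → ℝ} (hd : ∀ n, 0 ≤ d n) (hκ : IsNonnegSummable κ)
    (hζ : ∀ n, 0 ≤ ζ n) (h : ∀ n, d (n + 1) ≤ (1 + κ n) * d n + ζ n) (n m : ℕ) :
    d (n + m) ≤ Real.exp (∑' k, κ k) * (d n + ∑ k ∈ Finset.range m, ζ (n + k)) := by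
  have key : ∀ m, d (n + m) ≤ Real.exp (∑ k ∈ Finset.range m, κ (n + k)) *
      (d n + ∑ k ∈ Finset.range m, ζ (n + k)) := by
    intro m
    induction m with
    | zero => simp
    | succ m ih =>
      rw [Finset.sum_range_succ, Finset.sum_range_succ, Real.exp_add]
      have h1 := h (n + m)
      have h2 : 1 + κ (n + m) ≤ Real.exp (κ (n + m)) := by
        linarith [Real.add_one_le_exp (κ (n + m))]
      have h3 : 1 ≤ Real.exp (∑ k ∈ Finset.range m, κ (n + k)) :=
        Real.one_le_exp (Finset.sum_nonneg fun k _ => hκ.1 _)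
      have h4 : 1 ≤ Real.exp (κ (n + m)) := Real.one_le_exp (hκ.1 _)
      have h5 : (1 + κ (n + m)) * d (n + m) ≤ Real.exp (κ (n + m)) *
          (Real.exp (∑ k ∈ Finset.range m, κ (n + k)) *
            (d n + ∑ k ∈ Finset.range m, ζ (n + k))) :=
        mul_le_mul h2 ih (hd _) (Real.exp_nonneg _)
      have h6 : ζ (n + m) ≤ Real.exp (∑ k ∈ Finset.range m, κ (n + k)) *
          Real.exp (κ (n + m)) * ζ (n + m) :=
        le_mul_of_one_le_left (hζ _) (one_le_mul_of_one_le_of_one_le h3 h4)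
      calc d (n + (m + 1)) ≤ (1 + κ (n + m)) * d (n + m) + ζ (n + m) := h1
        _ ≤ _ := by linarith
  refine (key m).trans ?_
  have h1 : ∑ k ∈ Finset.range m, κ (n + k) ≤ ∑' k, κ k := by
    have : ∑ k ∈ Finset.range m, κ (n + k) ≤ ∑ k ∈ Finset.range (n + m), κ k := by
      rw [Finset.sum_range_add]
      linarith [Finset.sum_nonneg (s := Finset.range n) fun k _ => hκ.1 k]
    exact this.trans (hκ.2.sum_le_tsum _ fun k _ => hκ.1 k)
  have h2 : 0 ≤ d n + ∑ k ∈ Finset.range m, ζ (n + k) :=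
    add_nonneg (hd n) (Finset.sum_nonneg fun k _ => hζ _)
  gcongr

/-- A uniform bound for quasi-Fejér sequences. -/
theorem le_of_quasiFejer {d κ ζ : ℕ → ℝ} (hd : ∀ n, 0 ≤ d n) (hκ : IsNonnegSummable κ)
    (hζ : IsNonnegSummable ζ) (h : ∀ n, d (n + 1) ≤ (1 + κ n) * d n + ζ n) (n : ℕ) :
    d n ≤ Real.exp (∑' k, κ k) * (d 0 + ∑' k, ζ k) := by
  have := le_mul_add_sum_of_le hd hκ hζ.1 h 0 n
  simp only [zero_add] at this
  refine this.trans ?_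
  gcongr
  exact hζ.2.sum_le_tsum _ fun k _ => hζ.1 k

/-- Deterministic Robbins–Siegmund lemma. -/
theorem tendsto_and_summable_of_quasiFejer {d κ ζ g : ℕ → ℝ} (hd : ∀ n, 0 ≤ d n)
    (hκ : IsNonnegSummable κ) (hζ : IsNonnegSummable ζ) (hg : ∀ n, 0 ≤ g n)
    (h : ∀ n, d (n + 1) ≤ (1 + κ n) * d n - g n + ζ n) :
    (∃ l, Tendsto d atTop (𝓝 l)) ∧ Summable g := by
  set M := Real.exp (∑' k, κ k) * (d 0 + ∑' k, ζ k) with hM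
  have hdM : ∀ n, d n ≤ M := le_of_quasiFejer hd hκ hζ fun n => by linarith [h n, hg n]
  have hM0 : 0 ≤ M := (hd 0).trans (hdM 0)
  set r : ℕ → ℝ := fun n => κ n * M + ζ n with hr
  have hr0 : ∀ n, 0 ≤ r n := fun n => add_nonneg (mul_nonneg (hκ.1 n) hM0) (hζ.1 n)
  have hrs : Summable r := (hκ.2.mul_right M).add hζ.2
  have hstep : ∀ n, d (n + 1) ≤ d n - g n + r n := fun n => by
    have := mul_le_mul_of_nonneg_left (hdM n) (hκ.1 n)
    have := h n
    simp only [hr]; linarith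
  have hsum : ∀ n, d n + ∑ k ∈ Finset.range n, g k ≤ d 0 + ∑ k ∈ Finset.range n, r k := by
    intro n
    induction n with
    | zero => simp
    | succ n ih => rw [Finset.sum_range_succ, Finset.sum_range_succ]; linarith [hstep n]
  have hgs : Summable g := summable_of_sum_range_le (c := d 0 + ∑' k, r k) hg fun n => by
    have := hrs.sum_le_tsum (Finset.range n) fun k _ => hr0 k
    linarith [hsum n, hd n]
  refine ⟨?_, hgs⟩
  have hanti : Antitone fun n => d n - ∑ k ∈ Finset.range n, r k :=
    antitone_nat_of_succ_le fun n => by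
      rw [Finset.sum_range_succ]; linarith [hstep n, hg n]
  have hbdd : BddBelow (Set.range fun n => d n - ∑ k ∈ Finset.range n, r k) :=
    ⟨-∑' k, r k, by
      rintro _ ⟨n, rfl⟩
      have := hrs.sum_le_tsum (Finset.range n) fun k _ => hr0 k
      have := hd n
      simp only; linarith⟩
  have := (tendsto_atTop_ciInf hanti hbdd).add hrs.hasSum.tendsto_sum_nat
  exact ⟨_, by simpa using this⟩

end RealSequences

/-! ### Weak limits along ultrafilters -/

section Weak

variable {H : Type*} [NormedAddCommGroup H] [InnerProductSpace ℝ H]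

/-- Bounded sequences in a Hilbert space have weak limits along ultrafilters. -/
theorem exists_weak_limit [CompleteSpace H] {ι : Type*} {x : ι → H} {R : ℝ} (hx : ∀ n, ‖x n‖ ≤ R)
    (F : Ultrafilter ι) : ∃ l, ∀ y, Tendsto (fun n => inner ℝ (x n) y) F (𝓝 (inner ℝ l y)) := by
  have hR : ∀ y, ∃ t, Tendsto (fun n => inner ℝ (x n) y) F (𝓝 t) := fun y => by
    have hc : IsCompact (Set.Icc (-(R * ‖y‖)) (R * ‖y‖)) := isCompact_Icc
    obtain ⟨t, -, ht⟩ := hc.ultrafilter_le_nhds (F.map fun n => inner ℝ (x n) y) (by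
      rw [le_principal_iff]
      refine Ultrafilter.mem_map.2 (Filter.univ_mem' fun n => ?_)
      have h1 := abs_le.1 (abs_real_inner_le_norm (x n) y)
      have h2 : ‖x n‖ * ‖y‖ ≤ R * ‖y‖ := by gcongr; exact hx n
      exact ⟨by linarith [h1.1], by linarith [h1.2]⟩)
    exact ⟨t, ht⟩
  choose f hf using hR
  let φ : H →ₗ[ℝ] ℝ :=
    { toFun := f
      map_add' := fun y z => tendsto_nhds_unique (hf _) (by
        simpa only [inner_add_right] using (hf y).add (hf z))
      map_smul' := fun c y => tendsto_nhds_unique (hf _) (by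
        simpa only [inner_smul_right, RingHom.id_apply, smul_eq_mul] using (hf y).const_mul c) }
  let ψ : StrongDual ℝ H := φ.mkContinuous R fun y => by
    refine le_of_tendsto (hf y).norm (Eventually.of_forall fun n => ?_)
    refine (norm_inner_le_norm _ _).trans ?_
    gcongr; exact hx n
  refine ⟨(InnerProductSpace.toDual ℝ H).symm ψ, fun y => ?_⟩
  rw [InnerProductSpace.toDual_symm_apply]
  exact hf y

/-- The pairing of a bounded weakly convergent net with a strongly convergent one. -/
theorem tendsto_inner_of_weak_of_strong {ι : Type*} {F : Filter ι} {x u : ι → H} {l v : H} {R : ℝ}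
    (hR : ∀ n, ‖x n‖ ≤ R)
    (hx : ∀ y, Tendsto (fun n => inner ℝ (x n) y) F (𝓝 (inner ℝ l y)))
    (hu : Tendsto u F (𝓝 v)) : Tendsto (fun n => inner ℝ (x n) (u n)) F (𝓝 (inner ℝ l v)) := by
  have h0 : Tendsto (fun n => inner ℝ (x n) (u n - v)) F (𝓝 0) := by
    refine squeeze_zero_norm (a := fun n => R * ‖u n - v‖) (fun n => ?_) ?_
    · refine (norm_inner_le_norm _ _).trans ?_
      gcongr; exact hR n
    · have : Tendsto (fun n => u n - v) F (𝓝 0) := by simpa using hu.sub_const v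
      simpa using this.norm.const_mul R
  simpa [inner_sub_right] using h0.add (hx v)

end Weak

/-! ### Minty's theorem via the Fitzpatrick function -/

section Resolvent

variable {H : Type*} [NormedAddCommGroup H] [InnerProductSpace ℝ H]

/-- A pair that is monotonically related to the graph of a maximally monotone operator lies in
the graph. -/
theorem IsMaximallyMonotone.mem_of_forall {A : H → Set H} (hA : IsMaximallyMonotone A) {x u : H}
    (h : ∀ y, ∀ v ∈ A y, 0 ≤ inner ℝ (x - y) (u - v)) : u ∈ A x := by
  -- Adjoining the single pair (x, u) to the graph keeps it monotone, so maximality forces it to be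
  -- there already.
  have h2 : A = fun y => A y ∪ {w | y = x ∧ w = u} := by
    refine hA.2 _ ?_ fun y => Set.subset_union_left
    rintro y z v (hv | ⟨rfl, rfl⟩) w (hw | ⟨rfl, rfl⟩)
    · exact hA.1 y z v hv w hw
    · rw [← neg_sub, ← neg_sub w v, inner_neg_neg]
      exact h y v hv
    · exact h z w hw
    · simp
  rw [h2]
  exact Or.inr ⟨rfl, rfl⟩

theorem mem_resolvent_lcomp_iff {A : H → Set H} {W : H →L[ℝ] H} {p y : H} :
    p ∈ resolvent (lcomp W A) y ↔ ∃ u ∈ A p, p + W u = y := by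
  simp [resolvent, inverse, lcomp, single, eq_neg_add_iff_add_eq]

theorem mem_zer_add_single_iff {E : Type*} [NormedAddCommGroup E] {A : E → Set E} {B : E → E}
    {x : E} :
    x ∈ zer (A + single B) ↔ -B x ∈ A x := by
  simp only [zer, single, Pi.add_apply, Set.mem_ofPred_eq, Set.mem_add, Set.mem_singleton_iff,
    exists_eq_left]
  constructor
  · rintro ⟨u, hu, h⟩
    rwa [← eq_neg_of_add_eq_zero_left h]
  · exact fun h => ⟨_, h, by simp⟩

theorem IsMaximallyMonotone.translate {A : H → Set H} (hA : IsMaximallyMonotone A) (y : H) :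
    IsMaximallyMonotone fun x => A (x + y) := by
  refine ⟨fun x z u hu v hv => by simpa using hA.1 _ _ u hu v hv, fun A' hA' hsub => ?_⟩
  have : A = fun x => A' (x - y) := by
    refine hA.2 _ (fun x z u hu v hv => by simpa using hA' _ _ u hu v hv) fun x => ?_
    simpa using hsub (x - y)
  funext x
  rw [this]; simp

/-- The epigraph of the Fitzpatrick function of `A`. -/
def fitzpatrickEpigraph (A : H → Set H) : Set (H × H × ℝ) :=
  {q | ∀ y, ∀ v ∈ A y, inner ℝ y q.2.1 + inner ℝ q.1 v - inner ℝ y v ≤ q.2.2}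

theorem isClosed_fitzpatrickEpigraph (A : H → Set H) : IsClosed (fitzpatrickEpigraph A) := by
  simp only [fitzpatrickEpigraph, Set.ofPred_forall]
  refine isClosed_iInter fun y => isClosed_iInter fun v => isClosed_iInter fun _ => ?_
  exact isClosed_le (by fun_prop) (by fun_prop)

theorem convex_fitzpatrickEpigraph (A : H → Set H) : Convex ℝ (fitzpatrickEpigraph A) := by
  rintro q hq r hr s t hs ht hst y v hv
  have h1 := mul_le_mul_of_nonneg_left (hq y v hv) hs
  have h2 := mul_le_mul_of_nonneg_left (hr y v hv) ht
  simp only [Prod.fst_add, Prod.snd_add, Prod.smul_fst, Prod.smul_snd, inner_add_left,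
    inner_add_right, inner_smul_left, inner_smul_right, smul_eq_mul, RCLike.conj_to_real]
  have h3 : inner ℝ y v = s * inner ℝ y v + t * inner ℝ y v := by rw [← add_mul, hst, one_mul]
  rw [h3]
  linarith

theorem IsMonotone.mem_fitzpatrickEpigraph {A : H → Set H} (hA : IsMonotone A) {x u : H}
    (hu : u ∈ A x) : (x, u, inner ℝ x u) ∈ fitzpatrickEpigraph A := fun y v hv => by
  have := hA x y u hu v hv
  simp only [inner_sub_left, inner_sub_right] at this
  simp only
  linarith

/-- A point (x, u, r) of the epigraph with r < ⟪x, u⟫ would make (x, u) monotonically related to the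
graph, hence a member of it; testing the epigraph condition at (x, u) then gives ⟪x, u⟫ ≤ r. -/
theorem IsMaximallyMonotone.inner_le_of_mem_fitzpatrickEpigraph {A : H → Set H}
    (hA : IsMaximallyMonotone A) {q : H × H × ℝ} (hq : q ∈ fitzpatrickEpigraph A) :
    inner ℝ q.1 q.2.1 ≤ q.2.2 := by
  by_contra! hlt
  have hmem : q.2.1 ∈ A q.1 := hA.mem_of_forall fun y v hv => by
    have := hq y v hv
    simp only [inner_sub_left, inner_sub_right]
    linarith
  have := hq _ _ hmem
  linarith

/-- A closed convex set of `H × H × ℝ` on which `(x, u, r) ↦ r + (⟪S x, x⟫ + ⟪W u, u⟫) / 2` is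
bounded below contains a minimiser of that function. -/
theorem exists_minimizer [CompleteSpace H] {S W : H →L[ℝ] H} (hS : IsSymm S) (hW : IsSymm W)
    {c : ℝ} (hc : 0 < c) (hSc : ∀ x, c * ‖x‖ ^ 2 ≤ inner ℝ (S x) x)
    (hWc : ∀ x, c * ‖x‖ ^ 2 ≤ inner ℝ (W x) x) {E : Set (H × H × ℝ)} (hE : IsClosed E)
    (hconv : Convex ℝ E) (hne : E.Nonempty) {φ : H × H × ℝ → ℝ}
    (hφ : ∀ q, φ q = q.2.2 + (inner ℝ (S q.1) q.1 + inner ℝ (W q.2.1) q.2.1) / 2)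
    (hbdd : ∀ q ∈ E, 0 ≤ φ q) : ∃ q ∈ E, ∀ q' ∈ E, φ q ≤ φ q' := by
  set m := sInf (φ '' E) with hm
  have hbb : BddBelow (φ '' E) := ⟨0, by rintro _ ⟨q, hq, rfl⟩; exact hbdd q hq⟩
  have hle : ∀ q ∈ E, m ≤ φ q := fun q hq => csInf_le hbb ⟨q, hq, rfl⟩
  have hex : ∀ n : ℕ, ∃ q ∈ E, φ q < m + 1 / ((n : ℝ) + 1) := fun n => by
    obtain ⟨_, ⟨q, hq, rfl⟩, h⟩ := exists_lt_of_csInf_lt (hne.image φ)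
      (lt_add_of_pos_right m (Nat.one_div_pos_of_nat (n := n) (α := ℝ)))
    exact ⟨q, hq, h⟩
  choose q hqE hq using hex
  -- Parallelogram identity: the value at the midpoint is the mean value minus one eighth of the
  -- quadratic form of the difference, and it is at least m.
  have hmid : ∀ a ∈ E, ∀ b ∈ E,
      c * (‖a.1 - b.1‖ ^ 2 + ‖a.2.1 - b.2.1‖ ^ 2) ≤ 4 * ((φ a - m) + (φ b - m)) := by
    intro a ha b hb
    have h := hle _ (hconv ha hb (by norm_num : (0 : ℝ) ≤ 1 / 2) (by norm_num : (0 : ℝ) ≤ 1 / 2)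
      (by norm_num))
    have h1 := hSc (a.1 - b.1)
    have h2 := hWc (a.2.1 - b.2.1)
    rw [hS.quad_sub] at h1
    rw [hW.quad_sub] at h2
    rw [hφ] at h ⊢
    rw [hφ b]
    simp only [Prod.fst_add, Prod.snd_add, Prod.smul_fst, Prod.smul_snd, hS.quad_add,
      hW.quad_add, map_smul, inner_smul_left, inner_smul_right, smul_eq_mul,
      RCLike.conj_to_real] at h
    linarith
  have hcau : ∀ f : H × H × ℝ → H, (∀ a ∈ E, ∀ b ∈ E,
      c * ‖f a - f b‖ ^ 2 ≤ 4 * ((φ a - m) + (φ b - m))) → CauchySeq fun n => f (q n) := by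
    intro f hf
    refine cauchySeq_of_le_tendsto_0 (fun N : ℕ => √(8 / c * (1 / ((N : ℝ) + 1)))) ?_ ?_
    · intro n k N hn hk
      rw [dist_eq_norm]
      refine Real.le_sqrt_of_sq_le ?_
      have h := hf _ (hqE n) _ (hqE k)
      have hn' : 1 / ((n : ℝ) + 1) ≤ 1 / ((N : ℝ) + 1) := Nat.one_div_le_one_div hn
      have hk' : 1 / ((k : ℝ) + 1) ≤ 1 / ((N : ℝ) + 1) := Nat.one_div_le_one_div hk
      have := hq n
      have := hq k
      rw [div_mul_eq_mul_div, le_div_iff₀ hc]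
      linarith
    · have h := ((tendsto_one_div_add_atTop_nhds_zero_nat (𝕜 := ℝ)).const_mul (8 / c)).sqrt
      simpa using h
  obtain ⟨x, hx⟩ := cauchySeq_tendsto_of_complete (hcau (fun a => a.1) fun a ha b hb => by
    have := hmid a ha b hb
    have : 0 ≤ c * ‖a.2.1 - b.2.1‖ ^ 2 := by positivity
    linarith)
  obtain ⟨u, hu⟩ := cauchySeq_tendsto_of_complete (hcau (fun a => a.2.1) fun a ha b hb => by
    have := hmid a ha b hb
    have : 0 ≤ c * ‖a.1 - b.1‖ ^ 2 := by positivity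
    linarith)
  have hφm : Tendsto (fun n => φ (q n)) atTop (𝓝 m) := by
    have h2 : Tendsto (fun n : ℕ => m + 1 / ((n : ℝ) + 1)) atTop (𝓝 m) := by
      simpa using (tendsto_one_div_add_atTop_nhds_zero_nat (𝕜 := ℝ)).const_add m
    exact tendsto_of_tendsto_of_tendsto_of_le_of_le tendsto_const_nhds h2
      (fun n => hle _ (hqE n)) fun n => (hq n).le
  have hquad : Tendsto (fun n => (inner ℝ (S (q n).1) (q n).1 +
      inner ℝ (W (q n).2.1) (q n).2.1) / 2) atTop
      (𝓝 ((inner ℝ (S x) x + inner ℝ (W u) u) / 2)) :=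
    ((((S.continuous.tendsto x).comp hx).inner hx).add
      (((W.continuous.tendsto u).comp hu).inner hu)).div_const 2
  -- The third coordinate is not controlled by strong convexity; it converges because φ and its
  -- quadratic part do.
  have hr : Tendsto (fun n => (q n).2.2) atTop
      (𝓝 (m - (inner ℝ (S x) x + inner ℝ (W u) u) / 2)) := by
    refine (hφm.sub hquad).congr fun n => ?_
    rw [hφ]; ring
  refine ⟨(x, u, m - (inner ℝ (S x) x + inner ℝ (W u) u) / 2),
    hE.mem_of_tendsto (hx.prodMk_nhds (hu.prodMk_nhds hr)) (Eventually.of_forall hqE),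
    fun q' hq' => ?_⟩
  rw [hφ]
  simpa using hle q' hq'

theorem nonneg_of_forall_mul_add_sq {a b : ℝ} (h : ∀ t, 0 < t → t ≤ 1 → 0 ≤ t * a + t ^ 2 * b) :
    0 ≤ a := by
  have h1 : Tendsto (fun t : ℝ => a + t * b) (𝓝[>] 0) (𝓝 a) := by
    have : Tendsto (fun t : ℝ => a + t * b) (𝓝 0) (𝓝 (a + 0 * b)) :=
      (tendsto_id.mul_const b).const_add a
    simp only [zero_mul, add_zero] at this
    exact this.mono_left nhdsWithin_le_nhds
  refine ge_of_tendsto h1 ?_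
  filter_upwards [Ioc_mem_nhdsGT (zero_lt_one (α := ℝ))] with t ht
  have := h t ht.1 ht.2
  have h2 : 0 ≤ t * (a + t * b) := by linarith
  exact nonneg_of_mul_nonneg_right h2 ht.1

/-- Minty's theorem at the origin, with respect to a variable metric. -/
theorem IsMaximallyMonotone.exists_add_eq_zero [CompleteSpace H] {A : H → Set H}
    (hA : IsMaximallyMonotone A)
    {S W : H →L[ℝ] H} (hW : IsSymm W) (hWS : ∀ x, W (S x) = x) (hSW : ∀ x, S (W x) = x)
    {c : ℝ} (hc : 0 < c) (hSc : ∀ x, c * ‖x‖ ^ 2 ≤ inner ℝ (S x) x)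
    (hWc : ∀ x, c * ‖x‖ ^ 2 ≤ inner ℝ (W x) x) : ∃ p, ∃ u ∈ A p, p + W u = 0 := by
  have hS : IsSymm S := hW.of_inverse hWS
  have hpos : ∀ x, 0 ≤ inner ℝ (S x) x := fun x => le_trans (by positivity) (hSc x)
  have hsq : ∀ x u, inner ℝ (S (x + W u)) (x + W u) =
      inner ℝ (S x) x + 2 * inner ℝ x u + inner ℝ (W u) u := fun x u => by
    rw [hS.quad_add, hSW, hS x (W u), hSW, real_inner_comm x u, real_inner_comm u (W u)]
  have hne : (fitzpatrickEpigraph A).Nonempty := by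
    by_cases h : ∃ x, (A x).Nonempty
    · obtain ⟨x, u, hu⟩ := h
      exact ⟨_, hA.1.mem_fitzpatrickEpigraph hu⟩
    · push Not at h
      exact ⟨0, fun y v hv => by simp [h y] at hv⟩
  obtain ⟨⟨x, u, r⟩, hq, hmin⟩ := exists_minimizer hS hW hc hSc hWc
    (isClosed_fitzpatrickEpigraph A) (convex_fitzpatrickEpigraph A) hne
    (φ := fun q => q.2.2 + (inner ℝ (S q.1) q.1 + inner ℝ (W q.2.1) q.2.1) / 2) (fun _ => rfl)
    fun q hq => by
      have h1 := hA.inner_le_of_mem_fitzpatrickEpigraph hq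
      have h2 := hpos (q.1 + W q.2.1)
      rw [hsq] at h2
      linarith
  have hr := hA.inner_le_of_mem_fitzpatrickEpigraph hq
  simp only at hr hmin
  -- First-order optimality along the segment from the minimiser to the graph point (y, v, ⟪y, v⟫).
  have hvar : ∀ y, ∀ v ∈ A y, 0 ≤ (inner ℝ y v - r) + inner ℝ (S x) (y - x)
      + inner ℝ (W u) (v - u) := fun y v hv => by
    refine nonneg_of_forall_mul_add_sq
      (b := (inner ℝ (S (y - x)) (y - x) + inner ℝ (W (v - u)) (v - u)) / 2) fun t h0 h1 => ?_
    have h := hmin _ ((convex_fitzpatrickEpigraph A).add_smul_sub_mem hq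
      (hA.1.mem_fitzpatrickEpigraph hv) ⟨h0.le, h1⟩)
    simp only [Prod.fst_add, Prod.snd_add, Prod.smul_fst, Prod.smul_snd, Prod.fst_sub,
      Prod.snd_sub, hS.quad_add, hW.quad_add, map_smul, inner_smul_left, inner_smul_right,
      smul_eq_mul, RCLike.conj_to_real] at h
    linarith
  -- Add to the variational inequality r ≥ ⟪x, u⟫ and the nonnegative square ⟪S(x + Wu), x + Wu⟫.
  have hmem : -S x ∈ A (-W u) := hA.mem_of_forall fun y v hv => by
    have h1 := hvar y v hv
    have h2 := hpos (x + W u)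
    rw [hsq] at h2
    have h3 : inner ℝ (W u) (S x) = inner ℝ x u := by
      rw [hW, hWS]
    have h4 : inner ℝ (-W u - y) (-S x - v) = inner ℝ (W u) (S x) + inner ℝ (W u) v
        + inner ℝ (S x) y + inner ℝ y v := by
      simp only [inner_sub_left, inner_sub_right, inner_neg_left, inner_neg_right,
        real_inner_comm (S x) y]
      ring
    rw [h4, h3]
    simp only [inner_sub_right] at h1
    linarith
  -- At this graph point the inequality reads r + ⟪x, u⟫ + ⟪Sx, x⟫ + ⟪Wu, u⟫ ≤ 0; with r ≥ ⟪x, u⟫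
  -- this forces x + Wu = 0.
  have h1 := hvar _ _ hmem
  have h3 : inner ℝ (W u) (S x) = inner ℝ x u := by
    rw [hW, hWS]
  have h4 : inner ℝ (S x) (W u) = inner ℝ x u := by rw [real_inner_comm, h3]
  simp only [inner_sub_right, inner_neg_left, inner_neg_right, h3, h4] at h1
  have h5 := hSc (x + W u)
  rw [hsq] at h5
  have h6 : c * ‖x + W u‖ ^ 2 ≤ 0 := by linarith
  have h7 : x + W u = 0 := by
    by_contra hne
    have : 0 < c * ‖x + W u‖ ^ 2 := by have := norm_pos_iff.2 hne; positivity
    linarith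
  refine ⟨-W u, -S x, hmem, ?_⟩
  rw [map_neg, hWS, ← neg_add, add_comm, h7, neg_zero]

theorem IsMonotone.quad_sub_le {A : H → Set H} (hA : IsMonotone A) {S W : H →L[ℝ] H}
    (hSW : ∀ x, S (W x) = x) {p q u v : H} (hu : u ∈ A p) (hv : v ∈ A q) :
    inner ℝ (S (p - q)) (p - q) ≤ inner ℝ (S ((p + W u) - (q + W v))) (p - q) := by
  have h := hA p q u hu v hv
  have e : S ((p + W u) - (q + W v)) = S (p - q) + (u - v) := by
    simp only [map_sub, map_add, hSW]; abel
  rw [e, inner_add_left, real_inner_comm (p - q) (u - v)]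
  linarith

/-- Minty's theorem for the resolvent `J_{W A}` in the metric defined by `W`. -/
theorem IsMaximallyMonotone.existsUnique_mem_resolvent [CompleteSpace H] {A : H → Set H}
    (hA : IsMaximallyMonotone A) {W : H →L[ℝ] H} (hW : IsSymm W) {c : ℝ} (hc : 0 < c)
    (hWc : ∀ x, c * ‖x‖ ^ 2 ≤ inner ℝ (W x) x) (y : H) :
    ∃! p, p ∈ resolvent (lcomp W A) y := by
  obtain ⟨S, hWS, hSW⟩ := exists_inverse hc hWc
  set M := ‖W‖ + 1
  have hM : 0 < M := by positivity
  have hSc : ∀ x, M⁻¹ * ‖x‖ ^ 2 ≤ inner ℝ (S x) x := fun x => by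
    rw [inv_mul_le_iff₀ hM]
    exact sq_norm_le_of_inverse hW hWS hc hWc (fun x => (W.le_opNorm x).trans (by
      have := norm_nonneg x; gcongr; simp [M])) x
  simp only [mem_resolvent_lcomp_iff]
  have hmin : 0 < min c M⁻¹ := lt_min hc (by positivity)
  obtain ⟨p, u, hu, h⟩ := (hA.translate y).exists_add_eq_zero hW hWS hSW hmin
    (fun x => le_trans (by gcongr; exact min_le_right _ _) (hSc x))
    (fun x => le_trans (by gcongr; exact min_le_left _ _) (hWc x))
  refine ⟨p + y, ⟨u, hu, by rw [add_right_comm, h, zero_add]⟩, ?_⟩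
  rintro q ⟨v, hv, hq⟩
  have h1 := hA.1.quad_sub_le hSW hv hu
  rw [hq, add_right_comm, h, zero_add, sub_self, map_zero, inner_zero_left] at h1
  have h2 := (hSc (q - (p + y))).trans h1
  by_contra hne
  have := norm_pos_iff.2 (sub_ne_zero.2 hne)
  have : 0 < M⁻¹ * ‖q - (p + y)‖ ^ 2 := by positivity
  linarith

end Resolvent

/-! ### Variable metric quasi-Fejér sequences -/

section QuasiFejer

theorem IsNonnegSummable.add {a b : ℕ → ℝ} (ha : IsNonnegSummable a) (hb : IsNonnegSummable b) :
    IsNonnegSummable fun n => a n + b n :=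
  ⟨fun n => add_nonneg (ha.1 n) (hb.1 n), ha.2.add hb.2⟩

theorem IsNonnegSummable.mul_const {a : ℕ → ℝ} (ha : IsNonnegSummable a) {c : ℝ} (hc : 0 ≤ c) :
    IsNonnegSummable fun n => a n * c :=
  ⟨fun n => mul_nonneg (ha.1 n) hc, ha.2.mul_right c⟩

theorem IsNonnegSummable.mul {a b : ℕ → ℝ} (ha : IsNonnegSummable a) (hb : IsNonnegSummable b) :
    IsNonnegSummable fun n => a n * b n :=
  ⟨fun n => mul_nonneg (ha.1 n) (hb.1 n),
    (ha.2.mul_right (∑' k, b k)).of_nonneg_of_le (fun n => mul_nonneg (ha.1 n) (hb.1 n)) fun n =>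
      mul_le_mul_of_nonneg_left (hb.2.le_tsum n fun k _ => hb.1 k) (ha.1 n)⟩

variable {H : Type*} [NormedAddCommGroup H] [InnerProductSpace ℝ H]

/-- A sequence of uniformly equivalent metrics, almost decreasing in the Loewner order. -/
structure IsMetricSequence (S : ℕ → H →L[ℝ] H) (c C : ℝ) (η : ℕ → ℝ) : Prop where
  symm : ∀ n, IsSymm (S n)
  pos : 0 < c
  nonneg : 0 ≤ C
  lower : ∀ n x, c * ‖x‖ ^ 2 ≤ inner ℝ (S n x) x
  upper : ∀ n x, ‖S n x‖ ≤ C * ‖x‖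
  summable : IsNonnegSummable η
  step : ∀ n x, inner ℝ (S (n + 1) x) x ≤ (1 + η n) * inner ℝ (S n x) x

/-- Variable metric quasi-Fejér monotonicity of `x` relative to `Z`. -/
structure IsQuasiFejer (S : ℕ → H →L[ℝ] H) (x : ℕ → H) (Z : Set H) (κ ζ : ℕ → ℝ) : Prop where
  summable_mul : IsNonnegSummable κ
  summable_add : IsNonnegSummable ζ
  le : ∀ z ∈ Z, ∀ n, inner ℝ (S (n + 1) (x (n + 1) - z)) (x (n + 1) - z) ≤
    (1 + κ n) * inner ℝ (S n (x n - z)) (x n - z) + ζ n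

variable {S : ℕ → H →L[ℝ] H} {c C : ℝ} {η : ℕ → ℝ} {x : ℕ → H} {Z : Set H} {κ ζ : ℕ → ℝ}

theorem IsMetricSequence.quad_nonneg (hS : IsMetricSequence S c C η) (n : ℕ) (x : H) :
    0 ≤ inner ℝ (S n x) x :=
  le_trans (by have := hS.pos; positivity) (hS.lower n x)

theorem IsMetricSequence.quad_le (hS : IsMetricSequence S c C η) (n : ℕ) (x : H) :
    inner ℝ (S n x) x ≤ C * ‖x‖ ^ 2 :=
  (abs_le.1 (abs_quad_le (hS.upper n) x)).2

theorem IsMetricSequence.exists_tendsto [CompleteSpace H] (hS : IsMetricSequence S c C η) (w : H) :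
    ∃ l, Tendsto (fun n => S n w) atTop (𝓝 l) := by
  refine exists_tendsto_of_quad_le hS.symm hS.nonneg hS.upper (hS.summable.mul_const hS.nonneg)
    (fun n x => ?_) w
  have h1 := hS.step n x
  have h2 := mul_le_mul_of_nonneg_left (hS.quad_le n x) (hS.summable.1 n)
  linarith

theorem IsQuasiFejer.exists_norm_le (hx : IsQuasiFejer S x Z κ ζ) (hS : IsMetricSequence S c C η)
    (hZ : Z.Nonempty) : ∃ R, ∀ n, ‖x n‖ ≤ R := by
  obtain ⟨z, hz⟩ := hZ
  have hb := le_of_quasiFejer (fun n => hS.quad_nonneg n (x n - z)) hx.summable_mul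
    hx.summable_add (hx.le z hz)
  set M := Real.exp (∑' k, κ k) * (inner ℝ (S 0 (x 0 - z)) (x 0 - z) + ∑' k, ζ k)
  refine ⟨√(M / c) + ‖z‖, fun n => ?_⟩
  have h1 : ‖x n - z‖ ≤ √(M / c) := Real.le_sqrt_of_sq_le (by
    rw [le_div_iff₀' hS.pos]
    exact (hS.lower n _).trans (hb n))
  calc ‖x n‖ = ‖(x n - z) + z‖ := by rw [sub_add_cancel]
    _ ≤ _ := (norm_add_le _ _).trans (by gcongr)

theorem IsQuasiFejer.exists_tendsto_quad (hx : IsQuasiFejer S x Z κ ζ)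
    (hS : IsMetricSequence S c C η) {z : H} (hz : z ∈ Z) :
    ∃ l, Tendsto (fun n => inner ℝ (S n (x n - z)) (x n - z)) atTop (𝓝 l) :=
  (tendsto_and_summable_of_quasiFejer (g := fun _ => 0) (fun n => hS.quad_nonneg n (x n - z))
    hx.summable_mul hx.summable_add (fun _ => le_rfl) fun n => by
      simpa using hx.le z hz n).1

/-- Two weak limits in `Z` of a quasi-Fejér sequence along ultrafilters agree. -/
theorem IsQuasiFejer.weak_limit_unique [CompleteSpace H] (hx : IsQuasiFejer S x Z κ ζ)
    (hS : IsMetricSequence S c C η) {z z' : H} (hz : z ∈ Z) (hz' : z' ∈ Z) {F F' : Ultrafilter ℕ}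
    (hF : (F : Filter ℕ) ≤ atTop) (hF' : (F' : Filter ℕ) ≤ atTop)
    (h : ∀ y, Tendsto (fun n => inner ℝ (x n) y) F (𝓝 (inner ℝ z y)))
    (h' : ∀ y, Tendsto (fun n => inner ℝ (x n) y) F' (𝓝 (inner ℝ z' y))) : z = z' := by
  obtain ⟨R, hR⟩ := hx.exists_norm_le hS ⟨z, hz⟩
  obtain ⟨l, hl⟩ := hx.exists_tendsto_quad hS hz
  obtain ⟨l', hl'⟩ := hx.exists_tendsto_quad hS hz'
  obtain ⟨a, ha⟩ := hS.exists_tendsto z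
  obtain ⟨a', ha'⟩ := hS.exists_tendsto z'
  have hw : Tendsto (fun n => S n (z - z')) atTop (𝓝 (a - a')) := by
    simpa using ha.sub ha'
  -- In the difference of the squared distances to z and z' the term quadratic in x_n cancels,
  -- leaving this pairing.
  have hlim : Tendsto (fun n => inner ℝ (x n) (S n (z - z'))) atTop
      (𝓝 ((inner ℝ a z - inner ℝ a' z' - l + l') / 2)) := by
    have hq := ((((ha.inner (tendsto_const_nhds (x := z))).sub
      (ha'.inner (tendsto_const_nhds (x := z')))).sub hl).add hl').div_const 2
    refine hq.congr fun n => ?_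
    rw [(hS.symm n).quad_sub, (hS.symm n).quad_sub, ← real_inner_comm (x n),
      (hS.symm n) (z - z'), inner_sub_right]
    ring
  have e1 := tendsto_nhds_unique (hlim.mono_left hF)
    (tendsto_inner_of_weak_of_strong hR h (hw.mono_left hF))
  have e2 := tendsto_nhds_unique (hlim.mono_left hF')
    (tendsto_inner_of_weak_of_strong hR h' (hw.mono_left hF'))
  have e3 : inner ℝ (a - a') (z - z') = 0 := by
    rw [real_inner_comm, inner_sub_left, ← e1, ← e2, sub_self]
  have e4 : c * ‖z - z'‖ ^ 2 ≤ 0 := by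
    rw [← e3]
    exact ge_of_tendsto (hw.inner (tendsto_const_nhds (x := z - z')))
      (Eventually.of_forall fun n => hS.lower n _)
  by_contra hne
  have := norm_pos_iff.2 (sub_ne_zero.2 hne)
  have := hS.pos
  have : 0 < c * ‖z - z'‖ ^ 2 := by positivity
  linarith

/-- Weak convergence of quasi-Fejér sequences whose weak cluster points lie in `Z`. -/
theorem IsQuasiFejer.exists_weak_limit [CompleteSpace H] (hx : IsQuasiFejer S x Z κ ζ)
    (hS : IsMetricSequence S c C η) (hZ : Z.Nonempty)
    (hcl : ∀ F : Ultrafilter ℕ, (F : Filter ℕ) ≤ atTop → ∀ l,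
      (∀ y, Tendsto (fun n => inner ℝ (x n) y) F (𝓝 (inner ℝ l y))) → l ∈ Z) :
    ∃ l ∈ Z, ∀ y, Tendsto (fun n => inner ℝ (x n) y) atTop (𝓝 (inner ℝ l y)) := by
  obtain ⟨R, hR⟩ := hx.exists_norm_le hS hZ
  have hF₀ := Ultrafilter.of_le (atTop : Filter ℕ)
  obtain ⟨l, hl⟩ := MonotoneInclusion.exists_weak_limit hR (Ultrafilter.of (atTop : Filter ℕ))
  refine ⟨l, hcl _ hF₀ l hl, fun y => (tendsto_iff_ultrafilter _ _ _).2 fun F hF => ?_⟩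
  obtain ⟨l', hl'⟩ := MonotoneInclusion.exists_weak_limit hR F
  rw [hx.weak_limit_unique hS (hcl _ hF₀ l hl) (hcl _ hF l' hl') hF₀ hF hl hl']
  exact hl' y

/-- A quasi-Fejér sequence whose distance to `Z` has lower limit zero is Cauchy. -/
theorem IsQuasiFejer.cauchySeq_of_liminf (hx : IsQuasiFejer S x Z κ ζ)
    (hS : IsMetricSequence S c C η)
    (hlim : liminf (fun n => Metric.infEDist (x n) Z) atTop = 0) : CauchySeq x := by
  have hc := hS.pos
  set E := Real.exp (∑' k, κ k) with hE
  have hE0 : 0 < E := Real.exp_pos _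
  have htail := tendsto_sum_nat_add ζ
  rw [Metric.cauchySeq_iff']
  intro ε hε
  -- Below, ρ bounds both the distance from x_n to a point of Z and the tail of ζ; E(Cρ² + ρ) then
  -- bounds all later squared distances to that point.
  have hcont : Tendsto (fun ρ : ℝ => E * (C * ρ ^ 2 + ρ)) (𝓝[>] 0) (𝓝 0) := by
    have h : Continuous fun ρ : ℝ => E * (C * ρ ^ 2 + ρ) := by fun_prop
    have := h.tendsto 0
    simp only [ne_eq, OfNat.ofNat_ne_zero, not_false_eq_true, zero_pow, mul_zero, add_zero] at this
    exact this.mono_left nhdsWithin_le_nhds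
  obtain ⟨ρ, hρ, hρ0⟩ := ((hcont.eventually (gt_mem_nhds
    (by positivity : 0 < c * (ε / 2) ^ 2))).and self_mem_nhdsWithin).exists
  replace hρ0 : 0 < ρ := hρ0
  have hfreq : ∃ᶠ n in atTop, Metric.infEDist (x n) Z < ENNReal.ofReal ρ :=
    frequently_lt_of_liminf_lt (by isBoundedDefault) (by
      rw [hlim]; exact ENNReal.ofReal_pos.2 hρ0)
  obtain ⟨n, hn, hnt⟩ := (hfreq.and_eventually (htail.eventually (gt_mem_nhds hρ0))).exists
  obtain ⟨z, hz, hxz⟩ := Metric.infEDist_lt_iff.1 hn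
  have hxz' : ‖x n - z‖ < ρ := by
    rw [← dist_eq_norm]; exact edist_lt_ofReal.1 hxz
  have hall : ∀ m, ‖x (n + m) - z‖ < ε / 2 := fun m => by
    have h1 := le_mul_add_sum_of_le (fun n => hS.quad_nonneg n (x n - z)) hx.summable_mul
      hx.summable_add.1 (hx.le z hz) n m
    have h2 : ∑ k ∈ Finset.range m, ζ (n + k) ≤ ∑' k, ζ (k + n) := by
      simp only [add_comm n]
      exact ((summable_nat_add_iff n).2 hx.summable_add.2).sum_le_tsum _
        fun k _ => hx.summable_add.1 _
    have h3 := hS.quad_le n (x n - z)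
    have h4 : C * ‖x n - z‖ ^ 2 ≤ C * ρ ^ 2 := by
      have := hS.nonneg
      gcongr
    have h5 := hS.lower (n + m) (x (n + m) - z)
    have h6 : E * (inner ℝ (S n (x n - z)) (x n - z) + ∑ k ∈ Finset.range m, ζ (n + k)) ≤
        E * (C * ρ ^ 2 + ρ) := by
      gcongr <;> linarith
    have h7 : c * ‖x (n + m) - z‖ ^ 2 < c * (ε / 2) ^ 2 := by linarith
    exact lt_of_pow_lt_pow_left₀ 2 (by positivity) (lt_of_mul_lt_mul_left h7 hc.le)
  refine ⟨n, fun m hm => ?_⟩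
  obtain ⟨k, rfl⟩ := Nat.exists_eq_add_of_le hm
  have h1 := hall k
  have h2 := hall 0
  rw [add_zero] at h2
  calc dist (x (n + k)) (x n) ≤ dist (x (n + k)) z + dist (x n) z := dist_triangle_right _ _ _
    _ < ε := by rw [dist_eq_norm, dist_eq_norm]; linarith

/-- A quasi-Fejér sequence relative to a set with nonempty interior converges strongly when the
metrics are almost increasing too. -/
theorem IsQuasiFejer.exists_tendsto_of_interior [CompleteSpace H] (hx : IsQuasiFejer S x Z κ ζ)
    (hS : IsMetricSequence S c C η) (hZ : (interior Z).Nonempty) {ν : ℕ → ℝ}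
    (hν : IsNonnegSummable ν)
    (hSν : ∀ n x, inner ℝ (S n x) x ≤ (1 + ν n) * inner ℝ (S (n + 1) x) x)
    {U : ℕ → H →L[ℝ] H} (hUS : ∀ n x, U n (S n x) = x) {K : ℝ} (hUK : ∀ n x, ‖U n x‖ ≤ K * ‖x‖)
    (hU : ∀ w, ∃ l, Tendsto (fun n => U n w) atTop (𝓝 l)) : ∃ l, Tendsto x atTop (𝓝 l) := by
  obtain ⟨z, hz⟩ := hZ
  obtain ⟨ρ, hρ, hball⟩ := Metric.nhds_basis_closedBall.mem_iff.1 (mem_interior_iff_mem_nhds.1 hz)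
  have hC := hS.nonneg
  set M := Real.exp (∑' k, κ k) * (C * (‖x 0 - z‖ + ρ) ^ 2 + ∑' k, ζ k) with hM
  have hζ0 : 0 ≤ ∑' k, ζ k := tsum_nonneg hx.summable_add.1
  have hM0 : 0 ≤ M := by positivity
  have hmem : ∀ h : H, ‖h‖ ≤ 1 → z + ρ • h ∈ Z := fun h hh => hball (by
    rw [Metric.mem_closedBall, dist_eq_norm, add_sub_cancel_left, norm_smul,
      Real.norm_of_nonneg hρ.le]
    exact mul_le_of_le_one_right hρ.le hh)
  have hbound : ∀ h : H, ‖h‖ ≤ 1 → ∀ n,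
      inner ℝ (S n (x n - (z + ρ • h))) (x n - (z + ρ • h)) ≤ M := fun h hh n => by
    refine (le_of_quasiFejer (fun n => hS.quad_nonneg n (x n - (z + ρ • h))) hx.summable_mul
      hx.summable_add (hx.le _ (hmem h hh)) n).trans ?_
    have h1 : ‖x 0 - (z + ρ • h)‖ ≤ ‖x 0 - z‖ + ρ := by
      rw [← sub_sub]
      refine (norm_sub_le _ _).trans ?_
      rw [norm_smul, Real.norm_of_nonneg hρ.le]
      gcongr
      exact mul_le_of_le_one_right hρ.le hh
    have h2 := hS.quad_le 0 (x 0 - (z + ρ • h))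
    rw [hM]
    gcongr
    exact h2.trans (by gcongr)
  set r : ℕ → ℝ := fun n => κ n * M + ζ n + ν n * (C * ρ ^ 2) with hr
  have hrs : IsNonnegSummable r :=
    ((hx.summable_mul.mul_const hM0).add hx.summable_add).add (hν.mul_const (by positivity))
  set w : ℕ → H := fun n => S n (x n - z) with hw
  set d : ℕ → ℝ := fun n => inner ℝ (S n (x n - z)) (x n - z) with hd
  have hd0 : ∀ n, 0 ≤ d n := fun n => hS.quad_nonneg n _
  -- Expand the quasi-Fejér inequality at z + ρh. The leftover ρ²⟪(S_n - S_{n+1})h, h⟫ is where the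
  -- metrics must be almost increasing.
  have hinner : ∀ h : H, ‖h‖ ≤ 1 → ∀ n, 2 * ρ * inner ℝ (w n - w (n + 1)) h ≤
      d n - d (n + 1) + r n := fun h hh n => by
    have h1 := hx.le _ (hmem h hh) n
    have h2 := mul_le_mul_of_nonneg_left (hbound h hh n) (hx.summable_mul.1 n)
    have e : ∀ n, inner ℝ (S n (x n - (z + ρ • h))) (x n - (z + ρ • h)) =
        d n - 2 * (ρ * inner ℝ (w n) h) + ρ ^ 2 * inner ℝ (S n h) h := fun n => by
      rw [← sub_sub, (hS.symm n).quad_sub, quad_smul, inner_smul_right]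
    have h3 : inner ℝ (S n h) h - inner ℝ (S (n + 1) h) h ≤ ν n * C := by
      have h4 := hSν n h
      have h5 : inner ℝ (S (n + 1) h) h ≤ C := (hS.quad_le (n + 1) h).trans
        (mul_le_of_le_one_right hC (pow_le_one₀ (norm_nonneg h) hh))
      have := mul_le_mul_of_nonneg_left h5 (hν.1 n)
      linarith
    have h6 := mul_le_mul_of_nonneg_left h3 (sq_nonneg ρ)
    rw [e, e] at h1
    rw [e] at h2
    rw [inner_sub_left, hr]
    simp only
    linarith
  have hnorm : ∀ n, 2 * ρ * dist (w n) (w (n + 1)) ≤ d n - d (n + 1) + r n := fun n => by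
    rw [dist_eq_norm]
    set y := w n - w (n + 1) with hy
    -- The unit vector along y turns the pairing into ‖y‖; if y = 0 the inverse is 0 and so is the
    -- test vector.
    have h1 := hinner (‖y‖⁻¹ • y) (by
      rw [norm_smul, norm_inv, norm_norm]; exact inv_mul_le_one) n
    rw [← hy, inner_smul_right, real_inner_self_eq_norm_sq] at h1
    rcases eq_or_ne ‖y‖ 0 with h0 | h0
    · rw [h0] at h1 ⊢; simpa using h1
    · rwa [sq, inv_mul_cancel_left₀ h0] at h1
  have hsum : Summable fun n => 2 * ρ * dist (w n) (w (n + 1)) := by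
    refine summable_of_sum_range_le (c := d 0 + ∑' k, r k) (fun n => by positivity) fun n => ?_
    calc ∑ k ∈ Finset.range n, 2 * ρ * dist (w k) (w (k + 1))
        ≤ ∑ k ∈ Finset.range n, (d k - d (k + 1) + r k) := Finset.sum_le_sum fun k _ => hnorm k
      _ = d 0 - d n + ∑ k ∈ Finset.range n, r k := by
        rw [Finset.sum_add_distrib, Finset.sum_range_sub']
      _ ≤ _ := by
        have := hrs.2.sum_le_tsum (Finset.range n) fun k _ => hrs.1 k
        linarith [hd0 n]
  obtain ⟨l, hl⟩ := cauchySeq_tendsto_of_complete (cauchySeq_of_summable_dist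
    ((summable_mul_left_iff (by positivity : 2 * ρ ≠ 0)).1 hsum))
  obtain ⟨t, ht⟩ := hU l
  -- x_n - z = U_n w_n, with w_n → l, U_n uniformly bounded and U_n l convergent.
  have h0 : Tendsto (fun n => U n (w n - l)) atTop (𝓝 0) := by
    refine squeeze_zero_norm (fun n => hUK n (w n - l)) ?_
    have : Tendsto (fun n => w n - l) atTop (𝓝 0) := by simpa using hl.sub_const l
    simpa using this.norm.const_mul K
  refine ⟨0 + t + z, ((h0.add ht).add_const z).congr fun n => ?_⟩
  simp [hw, hUS]

end QuasiFejer

/-! ### The forward-backward step and its perturbations -/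

section ForwardBackward

variable {H : Type*} [NormedAddCommGroup H] [InnerProductSpace ℝ H]

/-- Puts the resolvent inclusion in a form to be paired with differences in the metric S. -/
theorem eq_smul_of_add_eq {U S : H →L[ℝ] H} (hSU : ∀ x, S (U x) = x) {γ : ℝ} {p v x b : H}
    (h : p + (γ • U) v = x - γ • U b) : S (x - p) = γ • (v + b) := by
  have : x - p = U (γ • (v + b)) := by
    rw [sub_eq_iff_eq_add.1 h.symm, map_smul, map_add, smul_add, smul_apply]
    abel
  rw [this, hSU]

/-- One exact forward-backward step in the metric of `S = U⁻¹`. -/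
theorem forwardBackward_quad_le {A : H → Set H} (hA : IsMonotone A) {β : ℝ} {B : H → H}
    (hB : IsCocoercive β B) {U S : H →L[ℝ] H} (hU : IsSymm U) (hUS : ∀ x, U (S x) = x)
    (hSU : ∀ x, S (U x) = x) {μ : ℝ} (hμ : ∀ x, ‖U x‖ ≤ μ * ‖x‖) {γ : ℝ} (hγ : 0 ≤ γ)
    {x q u z : H} (hu : u ∈ A q) (hq : S (x - q) = γ • (u + B x)) (hz : -B z ∈ A z) :
    inner ℝ (S (q - z)) (q - z) ≤ inner ℝ (S (x - z)) (x - z)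
      - inner ℝ (S (x - q - γ • U (B x - B z))) (x - q - γ • U (B x - B z))
      - γ * (2 * β - γ * μ) * ‖B x - B z‖ ^ 2 := by
  have hS : IsSymm S := hU.of_inverse hUS
  set D := B x - B z with hD
  have h1 : γ * inner ℝ D (q - z) ≤ inner ℝ (S (x - q)) (q - z) := by
    have h := mul_nonneg hγ (hA q z u hu _ hz)
    rw [hq, inner_smul_left, RCLike.conj_to_real]
    have e : inner ℝ (u + B x) (q - z) = inner ℝ (q - z) (u - -B z) + inner ℝ D (q - z) := by
      rw [real_inner_comm (u - -B z), ← inner_add_left, hD]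
      congr 1; abel
    rw [e]; linarith
  have h2 := mul_le_mul_of_nonneg_left (hB x z) hγ
  have h3 : inner ℝ (x - z) D = inner ℝ (x - q) D + inner ℝ D (q - z) := by
    rw [real_inner_comm (q - z) D, ← inner_add_left, sub_add_sub_cancel]
  have h4 : inner ℝ (S (x - q)) (γ • U D) = γ * inner ℝ (x - q) D := by
    rw [inner_smul_right, hS, hSU, real_inner_comm]
  have h5 : inner ℝ (S (γ • U D)) (γ • U D) = γ ^ 2 * inner ℝ (U D) D := by
    rw [quad_smul, hSU, real_inner_comm]
  have h6 := mul_le_mul_of_nonneg_left ((abs_le.1 (abs_quad_le hμ D)).2) (sq_nonneg γ)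
  have h7 : inner ℝ (S (x - z)) (x - z) = inner ℝ (S (x - q)) (x - q)
      + 2 * inner ℝ (S (x - q)) (q - z) + inner ℝ (S (q - z)) (q - z) := by
    rw [← hS.quad_add, sub_add_sub_cancel]
  rw [hS.quad_sub (x - q), h4, h5, h7]
  rw [← hD, h3] at h2
  linarith

/-- Effect on the backward step of an error in the forward step. -/
theorem norm_sub_le_of_perturbed {A : H → Set H} (hA : IsMonotone A) {S : H →L[ℝ] H} {μ : ℝ}
    (hμ0 : 0 ≤ μ) (hSμ : ∀ x, ‖x‖ ^ 2 ≤ μ * inner ℝ (S x) x) {γ K : ℝ} (hγ : 0 ≤ γ)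
    (hK : γ * μ ≤ K) {x p q u v c b : H} (hu : u ∈ A q) (hv : v ∈ A p)
    (hq : S (x - q) = γ • (u + c)) (hp : S (x - p) = γ • (v + (c + b))) :
    ‖p - q‖ ≤ K * ‖b‖ := by
  -- In the pairing with p - q, monotonicity discards the first term and only the error b remains.
  have e : S (p - q) = -(γ • (v - u)) - γ • b := by
    rw [← sub_sub_sub_cancel_left q p x, map_sub, hq, hp, ← smul_sub, ← smul_neg, ← smul_sub]
    congr 1; abel
  have h1 := mul_nonneg hγ (hA p q v hv u hu)
  have h2 := hSμ (p - q)
  have h3 : inner ℝ (S (p - q)) (p - q) ≤ γ * (‖b‖ * ‖p - q‖) := by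
    rw [e, inner_sub_left, inner_neg_left, inner_smul_left, inner_smul_left,
      real_inner_comm (p - q) (v - u)]
    simp only [RCLike.conj_to_real]
    have h4 := mul_le_mul_of_nonneg_left (abs_le.1 (abs_real_inner_le_norm b (p - q))).1 hγ
    linarith
  have h4 : ‖p - q‖ ^ 2 ≤ K * (‖b‖ * ‖p - q‖) := calc
    ‖p - q‖ ^ 2 ≤ μ * (γ * (‖b‖ * ‖p - q‖)) := h2.trans (mul_le_mul_of_nonneg_left h3 hμ0)
    _ = γ * μ * (‖b‖ * ‖p - q‖) := by ring
    _ ≤ _ := by gcongr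
  rcases (norm_nonneg (p - q)).eq_or_lt with h0 | h0
  · rw [← h0]
    exact mul_nonneg ((mul_nonneg hγ hμ0).trans hK) (norm_nonneg b)
  · have h5 : 0 ≤ ‖p - q‖ * (K * ‖b‖ - ‖p - q‖) := by linarith
    linarith [nonneg_of_mul_nonneg_right h5 h0]

/-- A relaxed step with an error, measured in the next metric. -/
theorem relaxed_quad_le {S T : H →L[ℝ] H} (hS : IsSymm S) (hpos : ∀ x, 0 ≤ inner ℝ (S x) x)
    {C : ℝ} (hC0 : 0 ≤ C) (hC : ∀ x, ‖S x‖ ≤ C * ‖x‖) {η : ℝ} (hη : 0 ≤ η)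
    (hT : ∀ x, inner ℝ (T x) x ≤ (1 + η) * inner ℝ (S x) x) {l δ ε g : ℝ} (hε : 0 ≤ ε)
    (hl : l ∈ Set.Icc ε 1) (hg : 0 ≤ g) {x q z e : H} (he : ‖e‖ ≤ δ)
    (hq : inner ℝ (S (q - z)) (q - z) ≤ inner ℝ (S (x - z)) (x - z) - g) :
    inner ℝ (T (x + l • (q + e - x) - z)) (x + l • (q + e - x) - z) ≤
      (1 + (η + δ + η * δ)) * inner ℝ (S (x - z)) (x - z) - ε * g
        + (1 + η) * (C * (δ + δ ^ 2)) := by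
  have hδ : 0 ≤ δ := (norm_nonneg e).trans he
  have hl0 : 0 ≤ l := hε.trans hl.1
  have e1 : x + l • (q + e - x) - z = ((x - z) + l • ((q - z) - (x - z))) + l • e := by
    simp only [smul_sub, smul_add]; abel
  have he' : ‖l • e‖ ≤ δ := by
    rw [norm_smul, Real.norm_of_nonneg hl0]
    exact (mul_le_of_le_one_left (norm_nonneg e) hl.2).trans he
  have h1 := hS.quad_convex hpos hl0 hl.2 (x - z) (q - z)
  have h2 := hS.quad_add_le hpos hC0 hC (u := (x - z) + l • ((q - z) - (x - z))) he'
  rw [← e1] at h2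
  have h3 := hT (x + l • (q + e - x) - z)
  set X := inner ℝ (S (x - z)) (x - z)
  have h4 : (1 - l) * X + l * inner ℝ (S (q - z)) (q - z) ≤ X - ε * g := by
    have := mul_le_mul_of_nonneg_left hq hl0
    have := mul_le_mul_of_nonneg_right hl.1 hg
    linarith
  have h5 := mul_le_mul_of_nonneg_left (h1.trans h4) (by positivity : 0 ≤ 1 + δ)
  have h6 := mul_le_mul_of_nonneg_left (h2.trans (add_le_add_left h5 _))
    (by positivity : 0 ≤ 1 + η)
  -- The factor (1 + η)(1 + δ) also multiplies the gain; the surplus is dropped.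
  have h7 : 0 ≤ (δ + η + η * δ) * (ε * g) := by positivity
  linarith

/-- Pairing the weak limit of x_n - l with the strong limit of Bx_n - Bl gives 0, which dominates
β‖d - Bl‖² by cocoercivity. -/
theorem IsCocoercive.tendsto_of_weak {β : ℝ} (hβ : 0 < β) {B : H → H} (hB : IsCocoercive β B)
    {ι : Type*} {F : Filter ι} {x : ι → H} {l d : H} {R : ℝ} (hR : ∀ n, ‖x n‖ ≤ R)
    (hx : ∀ y, Tendsto (fun n => inner ℝ (x n) y) F (𝓝 (inner ℝ l y)))
    (hBx : Tendsto (fun n => B (x n)) F (𝓝 d)) [F.NeBot] : B l = d := by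
  have h1 : Tendsto (fun n => inner ℝ (x n - l) (B (x n) - B l)) F (𝓝 0) := by
    have h := (tendsto_inner_of_weak_of_strong hR hx (hBx.sub_const (B l))).sub
      ((tendsto_const_nhds (x := l)).inner (hBx.sub_const (B l)))
    simpa [← inner_sub_left] using h
  have h2 : Tendsto (fun n => β * ‖B (x n) - B l‖ ^ 2) F (𝓝 (β * ‖d - B l‖ ^ 2)) :=
    ((hBx.sub_const (B l)).norm.pow 2).const_mul β
  have h3 : β * ‖d - B l‖ ^ 2 ≤ 0 := le_of_tendsto_of_tendsto' h2 h1 fun n => hB _ _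
  by_contra hne
  have := norm_pos_iff.2 (sub_ne_zero.2 (Ne.symm hne))
  have : 0 < β * ‖d - B l‖ ^ 2 := by positivity
  linarith

/-- The graph of a maximally monotone operator is closed for weak-strong convergence. -/
theorem IsMaximallyMonotone.mem_of_weak_of_strong {A : H → Set H} (hA : IsMaximallyMonotone A)
    {ι : Type*} {F : Filter ι} [F.NeBot] {x u : ι → H} {l v : H} {R : ℝ} (hR : ∀ n, ‖x n‖ ≤ R)
    (hu : ∀ n, u n ∈ A (x n))
    (hx : ∀ y, Tendsto (fun n => inner ℝ (x n) y) F (𝓝 (inner ℝ l y)))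
    (huv : Tendsto u F (𝓝 v)) : v ∈ A l := by
  refine hA.mem_of_forall fun y w hw => ?_
  have h := (tendsto_inner_of_weak_of_strong hR hx (huv.sub_const w)).sub
    ((tendsto_const_nhds (x := y)).inner (huv.sub_const w))
  simp only [← inner_sub_left] at h
  exact ge_of_tendsto h (Eventually.of_forall fun n => hA.1 _ _ _ (hu n) _ hw)

end ForwardBackward

theorem IsSymm.smul {H : Type*} [NormedAddCommGroup H] [InnerProductSpace ℝ H] {U : H →L[ℝ] H}
    (hU : IsSymm U) (t : ℝ) : IsSymm (t • U) := fun x y => by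
  simp only [smul_apply, inner_smul_left, hU x y]

theorem WeaklyTendsto.unique {H : Type*} [NormedAddCommGroup H] [InnerProductSpace ℝ H]
    [CompleteSpace H] {x : ℕ → H} {l l' : H} (h : WeaklyTendsto x l)
    (h' : Tendsto x atTop (𝓝 l')) : l' = l := by
  rw [weaklyTendsto_iff] at h
  exact ext_inner_right ℝ fun y => tendsto_nhds_unique (h'.inner tendsto_const_nhds) (h y)

end MonotoneInclusion

/-! ### Convergence of the algorithm -/

open MonotoneInclusion

theorem theoremt {H : Type*} [NormedAddCommGroup H] [InnerProductSpace ℝ H] [CompleteSpace H]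
    (A : H → Set H) (hA : MonotoneInclusion.IsMaximallyMonotone A)
    (α : ℝ) (hα : 0 < α) (β : ℝ) (hβ : 0 < β)
    (B : H → H) (hB : MonotoneInclusion.IsCocoercive β B)
    (η : ℕ → ℝ) (hη : MonotoneInclusion.IsNonnegSummable η)
    (U : ℕ → H →L[ℝ] H) (hU : ∀ n, U n ∈ MonotoneInclusion.posClass H α)
    (μ : ℝ) (hμ : IsLUB (Set.range fun n => ‖U n‖) μ)
    (hUη : ∀ n, U n ≤ (1 + η n) • U (n + 1))
    (ε : ℝ) (hε : ε ∈ Set.Ioc 0 (min 1 (2 * β / (μ + 1))))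
    (lam : ℕ → ℝ) (hlam : ∀ n, lam n ∈ Set.Icc ε 1)
    (γ : ℕ → ℝ) (hγ : ∀ n, ε ≤ γ n ∧ γ n * μ ≤ 2 * β - ε)
    (a b : ℕ → H) (ha : Summable fun n => ‖a n‖) (hb : Summable fun n => ‖b n‖)
    (Z : Set H) (hZ : Z = MonotoneInclusion.zer (A + MonotoneInclusion.single B))
    (hZne : Z.Nonempty) :
    -- the resolvents used by the algorithm are single-valued and defined everywhere
    (∀ n y, ∃! p, p ∈ MonotoneInclusion.resolvent
      (MonotoneInclusion.lcomp (γ n • U n) A) y) ∧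
    -- convergence of every sequence generated by the algorithm, from any starting point `x 0`
    ∀ x y p : ℕ → H,
      (∀ n, y n = x n - γ n • U n (B (x n) + b n)) →
      (∀ n, p n ∈ MonotoneInclusion.resolvent
        (MonotoneInclusion.lcomp (γ n • U n) A) (y n)) →
      (∀ n, x (n + 1) = x n + lam n • (p n + a n - x n)) →
      ∃ xbar ∈ Z,
        MonotoneInclusion.WeaklyTendsto x xbar ∧
        (Summable fun n => ‖B (x n) - B xbar‖ ^ 2) ∧
        ((liminf (fun n => Metric.infEDist (x n) Z) atTop = 0 ∨
          (∀ z ∈ Z, MonotoneInclusion.IsDemiregularAt A z ∨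
            MonotoneInclusion.IsDemiregularAt (MonotoneInclusion.single B) z) ∨
          ((interior Z).Nonempty ∧ ∃ ν : ℕ → ℝ, MonotoneInclusion.IsNonnegSummable ν ∧
            ∀ n, U (n + 1) ≤ (1 + ν n) • U n)) →
          Tendsto x atTop (𝓝 xbar)) := by
  have hε0 : 0 < ε := hε.1
  have hμU : ∀ n x, ‖U n x‖ ≤ μ * ‖x‖ := fun n x =>
    ((U n).le_opNorm x).trans (by gcongr; exact hμ.1 ⟨n, rfl⟩)
  have hμ0 : 0 ≤ μ := (norm_nonneg (U 0)).trans (hμ.1 ⟨0, rfl⟩)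
  have hγ0 : ∀ n, 0 < γ n := fun n => hε0.trans_le (hγ n).1
  have hγμ : ∀ n, γ n * μ ≤ 2 * β := fun n => by linarith [(hγ n).2]
  have hsymm : ∀ n, IsSymm (U n) := fun n => .of_isSelfAdjoint (hU n).1
  have hlow : ∀ n x, α * ‖x‖ ^ 2 ≤ inner ℝ (U n x) x := fun n => quad_lower_of_mem_posClass (hU n)
  have hUpos : ∀ n x, 0 ≤ inner ℝ (U n x) x := fun n x => le_trans (by positivity) (hlow n x)
  have hres : ∀ n y, ∃! p, p ∈ resolvent (lcomp (γ n • U n) A) y := fun n y =>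
    hA.existsUnique_mem_resolvent ((hsymm n).smul (γ n)) (mul_pos (hγ0 n) hα) (fun x => by
      rw [smul_apply, inner_smul_left, mul_assoc]
      exact mul_le_mul_of_nonneg_left (hlow n x) (hγ0 n).le) y
  refine ⟨hres, fun x y p hy hp hx => ?_⟩
  choose S hUS hSU using fun n => exists_inverse hα (hlow n)
  have hSμ : ∀ n x, ‖x‖ ^ 2 ≤ μ * inner ℝ (S n x) x := fun n =>
    sq_norm_le_of_inverse (hsymm n) (hUS n) hα (hlow n) (hμU n)
  have hSα : ∀ n x, ‖S n x‖ ≤ α⁻¹ * ‖x‖ := fun n => norm_inverse_le (hUS n) hα (hlow n)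
  have hSpos : ∀ n x, 0 ≤ inner ℝ (S n x) x := fun n x => by
    have := hUpos n (S n x)
    rwa [hUS, real_inner_comm] at this
  -- The constant μ + 1 avoids inverting μ, which vanishes when H is trivial.
  have hSm : IsMetricSequence S (μ + 1)⁻¹ α⁻¹ η :=
    { symm := fun n => (hsymm n).of_inverse (hUS n)
      pos := by positivity
      nonneg := by positivity
      lower := fun n x => by
        rw [inv_mul_le_iff₀ (by positivity)]
        linarith [hSμ n x, hSpos n x]
      upper := hSα
      summable := hη
      step := fun n => quad_inverse_antitone (hsymm n) (hUS n) (hUS (n + 1)) (hUpos n)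
        (by linarith [hη.1 n]) fun x => by
          simpa [inner_smul_left] using quad_le_of_le (hUη n) x }
  -- q_n is the error-free backward step; p_n + a_n is treated as a perturbation of it.
  choose q hq _ using fun n => hres n (x n - γ n • U n (B (x n)))
  choose u hu hqu using fun n => mem_resolvent_lcomp_iff.1 (hq n)
  choose v hv hpv using fun n => mem_resolvent_lcomp_iff.1 (hp n)
  have hqS : ∀ n, S n (x n - q n) = γ n • (u n + B (x n)) := fun n =>
    eq_smul_of_add_eq (hSU n) (hqu n)
  have hpS : ∀ n, S n (x n - p n) = γ n • (v n + (B (x n) + b n)) := fun n =>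
    eq_smul_of_add_eq (hSU n) ((hpv n).trans (hy n))
  have hzer : ∀ z, z ∈ Z ↔ -B z ∈ A z := fun z => by rw [hZ, mem_zer_add_single_iff]
  set δ : ℕ → ℝ := fun n => ‖a n‖ + 2 * β * ‖b n‖ with hδ
  have hδs : IsNonnegSummable δ :=
    ⟨fun n => by positivity, ha.add (hb.mul_left _)⟩
  have he : ∀ n, ‖p n + a n - q n‖ ≤ δ n := fun n => by
    have := norm_sub_le_of_perturbed hA.1 hμ0 (hSμ n) (hγ0 n).le (hγμ n) (hu n) (hv n) (hqS n)
      (hpS n)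
    rw [add_sub_right_comm, add_comm]
    exact (norm_add_le _ _).trans (by simp only [hδ]; gcongr)
  set κ : ℕ → ℝ := fun n => η n + δ n + η n * δ n with hκ
  set ζ : ℕ → ℝ := fun n => (1 + η n) * (α⁻¹ * (δ n + δ n ^ 2)) with hζ
  have hκs : IsNonnegSummable κ := (hη.add hδs).add (hη.mul hδs)
  have hζs : IsNonnegSummable ζ := by
    have h1 := (hδs.add (hδs.mul hδs)).mul_const (inv_nonneg.2 hα.le)
    convert h1.add (hη.mul h1) using 2 with n
    simp only [hζ]; ring
  set w : H → ℕ → H := fun z n => x n - q n - γ n • U n (B (x n) - B z) with hw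
  set g : H → ℕ → ℝ := fun z n => inner ℝ (S n (w z n)) (w z n) + ε ^ 2 * ‖B (x n) - B z‖ ^ 2
    with hg
  have hg0 : ∀ z n, 0 ≤ g z n := fun z n => add_nonneg (hSpos n _) (by positivity)
  have hstep : ∀ z ∈ Z, ∀ n, inner ℝ (S (n + 1) (x (n + 1) - z)) (x (n + 1) - z) ≤
      (1 + κ n) * inner ℝ (S n (x n - z)) (x n - z) - ε * g z n + ζ n := fun z hz n => by
    have h1 := forwardBackward_quad_le hA.1 hB (hsymm n) (hUS n) (hSU n) (hμU n) (hγ0 n).le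
      (hu n) (hqS n) ((hzer z).1 hz)
    -- One factor ε comes from the lower bound on γ_n, the other from γ_n μ ≤ 2β - ε.
    have h2 : ε ^ 2 ≤ γ n * (2 * β - γ n * μ) := by
      rw [sq]
      exact mul_le_mul (hγ n).1 (by linarith [(hγ n).2]) hε0.le (hγ0 n).le
    have h3 := mul_le_mul_of_nonneg_right h2 (sq_nonneg ‖B (x n) - B z‖)
    have h4 := relaxed_quad_le (hSm.symm n) (hSpos n) hSm.nonneg (hSα n) (hη.1 n) (hSm.step n)
      hε0.le (hlam n) (hg0 z n) (he n) (x := x n) (q := q n) (z := z) (by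
        simp only [hg, hw]; linarith)
    rw [hx n]
    rwa [add_sub_cancel] at h4
  have hF : IsQuasiFejer S x Z κ ζ :=
    ⟨hκs, hζs, fun z hz n => by
      linarith [hstep z hz n, mul_nonneg hε0.le (hg0 z n)]⟩
  have hgs : ∀ z ∈ Z, Summable (g z) := fun z hz =>
    (summable_mul_left_iff hε0.ne').1 (tendsto_and_summable_of_quasiFejer
      (fun n => hSpos n (x n - z)) hκs hζs (fun n => mul_nonneg hε0.le (hg0 z n)) (hstep z hz)).2
  have hBs : ∀ z ∈ Z, Summable fun n => ‖B (x n) - B z‖ ^ 2 := fun z hz =>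
    (summable_mul_left_iff (pow_pos hε0 2).ne').1 ((hgs z hz).of_nonneg_of_le
      (fun n => by positivity) fun n => le_add_of_nonneg_left (hSpos n _))
  have hsq0 : ∀ {f : ℕ → H}, Tendsto (fun n => ‖f n‖ ^ 2) atTop (𝓝 0) → Tendsto f atTop (𝓝 0) :=
    fun h => tendsto_zero_iff_norm_tendsto_zero.2 (by simpa using h.sqrt)
  have hB0 : ∀ z ∈ Z, Tendsto (fun n => B (x n) - B z) atTop (𝓝 0) := fun z hz =>
    hsq0 (hBs z hz).tendsto_atTop_zero
  have hBlim : ∀ z ∈ Z, Tendsto (fun n => B (x n)) atTop (𝓝 (B z)) := fun z hz => by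
    simpa using (hB0 z hz).add_const (B z)
  obtain ⟨z, hz⟩ := hZne
  have hw0 : Tendsto (w z) atTop (𝓝 0) := hsq0 (squeeze_zero (fun n => sq_nonneg _)
    (fun n => (hSμ n (w z n)).trans (mul_le_mul_of_nonneg_left
      (le_add_of_nonneg_right (by positivity) : _ ≤ g z n) hμ0))
    (by simpa using (hgs z hz).tendsto_atTop_zero.const_mul μ))
  have hxq : Tendsto (fun n => x n - q n) atTop (𝓝 0) := by
    have h1 : Tendsto (fun n => γ n • U n (B (x n) - B z)) atTop (𝓝 0) := by
      refine squeeze_zero_norm (a := fun n => 2 * β * ‖B (x n) - B z‖) (fun n => ?_)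
        (by simpa using (hB0 z hz).norm.const_mul (2 * β))
      rw [norm_smul, Real.norm_of_nonneg (hγ0 n).le]
      calc γ n * ‖U n (B (x n) - B z)‖ ≤ γ n * (μ * ‖B (x n) - B z‖) :=
            mul_le_mul_of_nonneg_left (hμU n _) (hγ0 n).le
        _ = γ n * μ * ‖B (x n) - B z‖ := by ring
        _ ≤ _ := mul_le_mul_of_nonneg_right (hγμ n) (norm_nonneg _)
    simpa [hw] using hw0.add h1
  -- u_n = γ_n⁻¹ S_n(x_n - q_n) - Bx_n, with γ_n⁻¹ ≤ ε⁻¹ and ‖S_n‖ ≤ α⁻¹.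
  have hulim : Tendsto u atTop (𝓝 (-B z)) := by
    have h1 : Tendsto (fun n => (γ n)⁻¹ • S n (x n - q n)) atTop (𝓝 0) := by
      refine squeeze_zero_norm (a := fun n => ε⁻¹ * (α⁻¹ * ‖x n - q n‖)) (fun n => ?_)
        (by simpa using (hxq.norm.const_mul α⁻¹).const_mul ε⁻¹)
      rw [norm_smul, norm_inv, Real.norm_of_nonneg (hγ0 n).le]
      gcongr
      · exact (hγ n).1
      · exact hSα n _
    have h2 := h1.sub (hBlim z hz)
    rw [zero_sub] at h2
    refine h2.congr fun n => ?_
    rw [hqS, inv_smul_smul₀ (hγ0 n).ne', add_sub_cancel_right]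
  have hqweak : ∀ {F : Filter ℕ}, F ≤ atTop → ∀ {l},
      (∀ y, Tendsto (fun n => inner ℝ (x n) y) F (𝓝 (inner ℝ l y))) →
      ∀ y, Tendsto (fun n => inner ℝ (q n) y) F (𝓝 (inner ℝ l y)) := fun hF l h y => by
    have h1 := (h y).sub ((hxq.mono_left hF).inner (tendsto_const_nhds (x := y)))
    simpa [← inner_sub_left] using h1
  obtain ⟨R, hR⟩ := hF.exists_norm_le hSm ⟨z, hz⟩
  obtain ⟨Q, hQ⟩ : ∃ Q, ∀ n, ‖q n‖ ≤ Q := by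
    obtain ⟨T, hT⟩ := hxq.norm.bddAbove_range
    refine ⟨R + T, fun n => ?_⟩
    have h1 := norm_sub_le (x n) (x n - q n)
    rw [sub_sub_cancel] at h1
    exact h1.trans (add_le_add (hR n) (hT ⟨n, rfl⟩))
  obtain ⟨l, hl, hxl⟩ := hF.exists_weak_limit hSm ⟨z, hz⟩ fun F hF l h => by
    rw [hzer, hB.tendsto_of_weak hβ hR h ((hBlim z hz).mono_left hF)]
    exact hA.mem_of_weak_of_strong hQ hu (hqweak hF h) (hulim.mono_left hF)
  have hweak : WeaklyTendsto x l := (weaklyTendsto_iff x l).2 hxl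
  refine ⟨l, hl, hweak, hBs l hl, ?_⟩
  rintro (hlim | hdemi | ⟨hint, ν, hν, hUν⟩)
  · obtain ⟨l', hl'⟩ := cauchySeq_tendsto_of_complete (hF.cauchySeq_of_liminf hSm hlim)
    exact hweak.unique hl' ▸ hl'
  · rcases hdemi l hl with hd | hd
    · have hBl : B l = B z := tendsto_nhds_unique (hBlim l hl) (hBlim z hz)
      -- Demiregularity of A acts on q_n, the point at which u_n is a value of A; x_n follows since
      -- x_n - q_n → 0.
      have hql := hd.2 q u hu (-B z) (hBl ▸ (hzer l).1 hl)
        ((weaklyTendsto_iff q l).2 (hqweak le_rfl hxl)) hulim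
      simpa using hql.add hxq
    · exact hd.2 x (fun n => B (x n)) (fun n => rfl) (B l) rfl hweak (hBlim l hl)
  · have hUν' : ∀ n x, inner ℝ (U (n + 1) x) x ≤ (1 + ν n) * inner ℝ (U n x) x := fun n x => by
      simpa [inner_smul_left] using quad_le_of_le (hUν n) x
    have hUquad : ∀ n x, inner ℝ (U n x) x ≤ μ * ‖x‖ ^ 2 := fun n x =>
      (abs_le.1 (abs_quad_le (hμU n) x)).2
    -- The condition on ν makes U_n almost decreasing: S_n is then almost increasing by order
    -- reversal, and U_n converges strongly.
    obtain ⟨l', hl'⟩ := hF.exists_tendsto_of_interior hSm hint hν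
      (fun n => quad_inverse_antitone (hsymm (n + 1)) (hUS (n + 1)) (hUS n) (hUpos (n + 1))
        (by linarith [hν.1 n]) (hUν' n)) hUS hμU
      (exists_tendsto_of_quad_le hsymm hμ0 hμU (hν.mul_const hμ0) fun n x => by
        linarith [hUν' n x, mul_le_mul_of_nonneg_left (hUquad n x) (hν.1 n)])
    exact hweak.unique hl' ▸ hl'
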